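/- Let $l,a>0$. The lasso graph $\Omega$ consists of an edge $e_1=[0,l]$ and a ring $e_2$ of circumference $a$, parametrized by $[0,a]$; the point $x=0$ of $e_1$ is the boundary vertex, and the end $x=l$ of $e_1$ and both ends $x=0$ and $x=a$ of the ring are identified with the interior vertex. Let $q$ be a real potential on $\Omega$ with $q_1=q|_{e_1}\in L^1(0,l)$ and $q_2=q|_{e_2}\in L^1(0,a)$. Consider the spectral problem $$-\varphi_j''+q_j\varphi_j=\mu\,\varphi_j \ \text{ a.e. on } e_j\quad (j=1,2),$$ $$\varphi_1'(0)=0,\qquad \varphi_1(l)=\varphi_2(0)=\varphi_2(a),\qquad -\varphi_1'(l)+\varphi_2'(0)-\varphi_2'(a)=0,$$ where $\varphi_1,\varphi_2$ are continuously differentiable up to the end points with absolutely continuous derivatives. Its eigenvalues, each repeated according to its multiplicity (the dimension of its eigenspace), can be listed as an infinite sequence $(\mu_n)$ of real numbers. For every such listing (in any order) let $\omega_n$ be the eigenfrequencies of the wave equation $u_{tt}-u_{xx}+qu=0$ on $\Omega$, i.e. $\omega_n=\sqrt{\mu_n}$ with the principal square root ($\omega_n=i\sqrt{|\mu_n|}$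 if $\mu_n<0$). Then the sequence $(\omega_n)$ is not separated: $$\inf_{m\neq n}|\omega_m-\omega_n|=0 .$$ -/

import Mathlib

open MeasureTheory Set

/-- `u` is a solution of `-u'' + q u = μ u` on the edge `[0, L]`, and `du` is its first derivative:
`u` is continuously differentiable on `[0, L]` (one-sided at the end points), `u' = du` is
absolutely continuous on `[0, L]`, and the equation holds almost everywhere on `[0, L]`. -/
structure IsEdgeSolution (L : ℝ) (q : ℝ → ℝ) (μ : ℝ) (u du : ℝ → ℝ) : Prop where
  hasDeriv : ∀ x ∈ Icc (0 : ℝ) L, HasDerivWithinAt u (du x) (Icc 0 L) x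
  absCont : AbsolutelyContinuousOnInterval du 0 L
  equation : ∀ᵐ x ∂(volume.restrict (Icc (0 : ℝ) L)),
    ∃ d2u : ℝ, HasDerivAt du d2u x ∧ -d2u + q x * u x = μ * u x

/-- The spectral problem on the lasso graph. The edge `e₁` is `[0, l]`, with the boundary vertex
at `x = 0` and the interior vertex at `x = l`; the ring is `[0, a]`, with `x = 0` and `x = a` both
identified with the interior vertex. The function is `u₁` on the edge and `u₂` on the ring, with
derivatives `du₁`, `du₂`. There is a Neumann condition at the boundary vertex, and
continuity and the Kirchhoff condition hold at the interior vertex. -/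
structure IsLassoSolution (l a : ℝ) (q₁ q₂ : ℝ → ℝ) (μ : ℝ) (u₁ du₁ u₂ du₂ : ℝ → ℝ) : Prop where
  edge : IsEdgeSolution l q₁ μ u₁ du₁
  ring : IsEdgeSolution a q₂ μ u₂ du₂
  neumann : du₁ 0 = 0
  cont_left : u₁ l = u₂ 0
  cont_right : u₁ l = u₂ a
  kirchhoff : -du₁ l + du₂ 0 - du₂ a = 0

/-- Real functions on the lasso graph: a function on the edge and a function on the ring. -/
abbrev LassoFun (l a : ℝ) : Type := (Icc (0 : ℝ) l → ℝ) × (Icc (0 : ℝ) a → ℝ)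

theorem IsEdgeSolution.zero (L : ℝ) (q : ℝ → ℝ) (μ : ℝ) :
    IsEdgeSolution L q μ (fun _ => 0) (fun _ => 0) where
  hasDeriv x _ := hasDerivWithinAt_const x _ 0
  absCont := by
    have h : LipschitzOnWith 0 (fun _ : ℝ => (0 : ℝ)) (uIcc 0 L) :=
      (LipschitzWith.const (0 : ℝ)).lipschitzOnWith
    exact h.absolutelyContinuousOnInterval
  equation := Filter.Eventually.of_forall fun x => ⟨0, hasDerivAt_const x 0, by simp⟩

theorem IsEdgeSolution.add {L : ℝ} {q : ℝ → ℝ} {μ : ℝ} {u du v dv : ℝ → ℝ}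
    (hu : IsEdgeSolution L q μ u du) (hv : IsEdgeSolution L q μ v dv) :
    IsEdgeSolution L q μ (u + v) (du + dv) where
  hasDeriv x hx := (hu.hasDeriv x hx).add (hv.hasDeriv x hx)
  absCont := hu.absCont.add hv.absCont
  equation := by
    filter_upwards [hu.equation, hv.equation] with x ⟨d, hd, hd'⟩ ⟨e, he, he'⟩
    exact ⟨d + e, hd.add he, by simp only [Pi.add_apply]; linarith⟩

theorem IsEdgeSolution.smul {L : ℝ} {q : ℝ → ℝ} {μ : ℝ} {u du : ℝ → ℝ} (c : ℝ)
    (hu : IsEdgeSolution L q μ u du) : IsEdgeSolution L q μ (c • u) (c • du) where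
  hasDeriv x hx := (hu.hasDeriv x hx).const_smul c
  absCont := hu.absCont.const_mul c
  equation := by
    filter_upwards [hu.equation] with x ⟨d, hd, hd'⟩
    exact ⟨c • d, hd.const_smul c, by
      simp only [Pi.smul_apply, smul_eq_mul]; linear_combination c * hd'⟩

/-- The eigenspace for `μ`: all functions on the lasso graph that solve the spectral problem with
spectral parameter `μ`. It is zero if `μ` is not an eigenvalue. -/
def lassoEigenspace (l a : ℝ) (q₁ q₂ : ℝ → ℝ) (μ : ℝ) : Submodule ℝ (LassoFun l a) where
  carrier := {φ | ∃ u₁ du₁ u₂ du₂ : ℝ → ℝ, IsLassoSolution l a q₁ q₂ μ u₁ du₁ u₂ du₂ ∧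
    (∀ x, φ.1 x = u₁ x) ∧ ∀ x, φ.2 x = u₂ x}
  zero_mem' := ⟨fun _ => 0, fun _ => 0, fun _ => 0, fun _ => 0,
    ⟨.zero _ _ _, .zero _ _ _, rfl, rfl, rfl, by simp⟩, fun _ => rfl, fun _ => rfl⟩
  add_mem' := by
    rintro φ ψ ⟨u₁, du₁, u₂, du₂, hu, h1, h2⟩ ⟨v₁, dv₁, v₂, dv₂, hv, k1, k2⟩
    refine ⟨u₁ + v₁, du₁ + dv₁, u₂ + v₂, du₂ + dv₂,
      ⟨hu.edge.add hv.edge, hu.ring.add hv.ring, ?_, ?_, ?_, ?_⟩, ?_, ?_⟩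
    · simp [hu.neumann, hv.neumann]
    · simp [hu.cont_left, hv.cont_left]
    · simp [hu.cont_right, hv.cont_right]
    · have := hu.kirchhoff
      have := hv.kirchhoff
      simp only [Pi.add_apply]
      linarith
    · intro x; simp [h1, k1]
    · intro x; simp [h2, k2]
  smul_mem' := by
    rintro c φ ⟨u₁, du₁, u₂, du₂, hu, h1, h2⟩
    refine ⟨c • u₁, c • du₁, c • u₂, c • du₂,
      ⟨hu.edge.smul c, hu.ring.smul c, ?_, ?_, ?_, ?_⟩, ?_, ?_⟩
    · simp [hu.neumann]
    · simp [hu.cont_left]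
    · simp [hu.cont_right]
    · simp only [Pi.smul_apply, smul_eq_mul]
      linear_combination c * hu.kirchhoff
    · intro x; simp [h1]
    · intro x; simp [h2]

/-- `ev` lists the eigenvalues of the spectral problem, each repeated according to its
multiplicity: every real `μ` occurs exactly as often as the dimension of its eigenspace. -/
def IsLassoEigenvalueSeq (l a : ℝ) (q₁ q₂ : ℝ → ℝ) (ev : ℕ → ℝ) : Prop :=
  ∀ μ : ℝ, {n : ℕ | ev n = μ}.encard =
    Cardinal.toENat (Module.rank ℝ (lassoEigenspace l a q₁ q₂ μ))

/-- The eigenfrequency `ω` of an eigenvalue `μ = ω²`, the principal square root of `μ`: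
it is `√μ` if `μ ≥ 0` and `i √|μ|` if `μ < 0`. -/
noncomputable def eigenfrequency (μ : ℝ) : ℂ := ⟨Real.sqrt μ, Real.sqrt (-μ)⟩

theorem eigenfrequency_sq (μ : ℝ) : eigenfrequency μ ^ 2 = (μ : ℂ) := by
  rcases le_total 0 μ with h | h
  · have h' : Real.sqrt (-μ) = 0 := Real.sqrt_eq_zero'.2 (by linarith)
    apply Complex.ext <;> simp [eigenfrequency, pow_two, h', Real.mul_self_sqrt h]
  · have h' : Real.sqrt μ = 0 := Real.sqrt_eq_zero'.2 h
    have h'' := Real.mul_self_sqrt (show 0 ≤ -μ by linarith)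
    apply Complex.ext <;> simp [eigenfrequency, pow_two, h', h'']

/-!
Write `μ = k²` and, for large `k`, let `u` be the Neumann solution on the edge and `c`, `s` the
cosine- and sine-type solutions on the ring, with `k` divided out of all derivatives. With `C`, `S`,
`C'`, `S'` the values and scaled derivatives of `c`, `s` at `a`, and `U`, `V` those of `u` at `l`,
the number `k²` is an eigenvalue when `Δ(k) = (2 - C - S') U - S V` vanishes and `U > 0`
(`lassoChar`, `eigenspace_ne_bot_of_lassoChar_eq_zero`).

By Dirichlet's approximation theorem there are arbitrarily large `b` with `b a ∈ 2πℤ` and `b l`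
close to `2πℤ` (`exists_resonant_seq`). Near such a `b` the six quantities are close to those of the
free problem near `k = 0`, where `Δ` would have a double zero: `C` and `U` are positive, `S` changes
sign at some `ν`, and `Δ` is positive at both ends of a window around `b`. At `ν` the Wronskian
identity `C S' - C' S = 1` (`wronskian_eq_one`) becomes `C S' = 1`, so `C + S' ≥ 2` and `Δ(ν) ≤ 0`.
If `Δ` is negative somewhere in the window, the intermediate value theorem gives two zeros of `Δ`
in it. Otherwise `Δ` has a local minimum with value zero at `ν`, so `C = S' = 1`. The derivative
of `Δ` at `ν` is `-2 ‖s‖² (C' U + V)` by the Lagrange identity (`hasDerivAt_lassoChar`), so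
`C' U + V = 0`, and then the eigenspace of `ν²` has dimension at least two
(`two_le_rank_eigenspace`). In both cases two members of any listing have eigenfrequencies in the
window (`double_or_two_zeros`, `exists_double_or_close_eigenvalues`).

The solutions for large `k` come from a Volterra equation that is a contraction, because its kernel
carries the factor `1 / k`; this also yields the asymptotics and the Lipschitz dependence on `k`
(`exists_solutionFamily`). For the existence of a listing, the windows show that the spectrum is
infinite, and it is countable since eigenfunctions of different eigenvalues are orthogonal
(`countable_eigenvalues`).
-/

open Filter Topology

/-! ### Solutions on a single edge: the Lagrange identity -/

theorem IsEdgeSolution.continuousOn {L : ℝ} {q : ℝ → ℝ} {μ : ℝ} {u du : ℝ → ℝ}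
    (hu : IsEdgeSolution L q μ u du) : ContinuousOn u (Icc 0 L) :=
  fun x hx => (hu.hasDeriv x hx).continuousWithinAt

theorem IsEdgeSolution.absCont_self {L : ℝ} (hL : 0 ≤ L) {q : ℝ → ℝ} {μ : ℝ} {u du : ℝ → ℝ}
    (hu : IsEdgeSolution L q μ u du) : AbsolutelyContinuousOnInterval u 0 L := by
  obtain ⟨C, hC⟩ := hu.absCont.exists_bound
  rw [uIcc_of_le hL] at hC
  have h : LipschitzOnWith C.toNNReal u (Icc 0 L) := by
    refine (convex_Icc 0 L).lipschitzOnWith_of_nnnorm_hasDerivWithin_le hu.hasDeriv fun x hx => ?_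
    rw [← NNReal.coe_le_coe, coe_nnnorm]
    exact (hC x hx).trans (Real.le_coe_toNNReal C)
  rw [← uIcc_of_le hL] at h
  exact h.absolutelyContinuousOnInterval

/-- The Lagrange identity. For `μ = ν` it says that the Wronskian is constant. -/
theorem IsEdgeSolution.lagrange {L : ℝ} (hL : 0 ≤ L) {q : ℝ → ℝ} {μ ν : ℝ} {u du v dv : ℝ → ℝ}
    (hu : IsEdgeSolution L q μ u du) (hv : IsEdgeSolution L q ν v dv) :
    (u L * dv L - du L * v L) - (u 0 * dv 0 - du 0 * v 0) =
      (μ - ν) * ∫ x in (0 : ℝ)..L, u x * v x := by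
  have hac : AbsolutelyContinuousOnInterval (fun x => u x * dv x - du x * v x) 0 L :=
    ((hu.absCont_self hL).mul hv.absCont).sub (hu.absCont.mul (hv.absCont_self hL))
  rw [← hac.integral_deriv_eq_sub, ← intervalIntegral.integral_const_mul]
  apply intervalIntegral.integral_congr_ae
  have h1 := (ae_restrict_iff' measurableSet_Icc).1 hu.equation
  have h2 := (ae_restrict_iff' measurableSet_Icc).1 hv.equation
  have h3 : ∀ᵐ x : ℝ, x ≠ 0 := by simp [ae_iff]
  have h4 : ∀ᵐ x : ℝ, x ≠ L := by simp [ae_iff]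
  filter_upwards [h1, h2, h3, h4] with x h1 h2 h3 h4 hx
  rw [uIoc_of_le hL] at hx
  have hx' : x ∈ Icc 0 L := ⟨hx.1.le, hx.2⟩
  have hnhds : Icc 0 L ∈ 𝓝 x := Icc_mem_nhds hx.1 (lt_of_le_of_ne hx.2 h4)
  obtain ⟨d, hd, hd'⟩ := h1 hx'
  obtain ⟨e, he, he'⟩ := h2 hx'
  have hu' := (hu.hasDeriv x hx').hasDerivAt hnhds
  have hv' := (hv.hasDeriv x hx').hasDerivAt hnhds
  have h := (hu'.mul he).sub (hd.mul hv')
  have h5 : deriv (fun x => u x * dv x - du x * v x) x =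
      du x * dv x + u x * e - (d * v x + du x * dv x) := h.deriv
  rw [h5]
  linear_combination -u x * he' + v x * hd'

/-- A solution that vanishes identically has vanishing derivative. -/
theorem IsEdgeSolution.deriv_eq_zero {L : ℝ} (hL : 0 < L) {q : ℝ → ℝ} {μ : ℝ} {u du : ℝ → ℝ}
    (hu : IsEdgeSolution L q μ u du) (h0 : ∀ x ∈ Icc 0 L, u x = 0) {x : ℝ} (hx : x ∈ Icc 0 L) :
    du x = 0 := by
  have h1 : HasDerivWithinAt u 0 (Icc 0 L) x :=
    (hasDerivWithinAt_const x (Icc 0 L) (0 : ℝ)).congr h0 (h0 x hx)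
  exact (uniqueDiffOn_Icc hL x hx).eq_deriv _ (hu.hasDeriv x hx) h1

/-- A continuous function with a nonzero value on `[0, L]` has positive `L²` norm. -/
theorem integral_mul_self_pos {L : ℝ} (hL : 0 < L) {u : ℝ → ℝ} (hu : ContinuousOn u (Icc 0 L))
    {x : ℝ} (hx : x ∈ Icc 0 L) (hux : u x ≠ 0) : 0 < ∫ x in (0 : ℝ)..L, u x * u x :=
  intervalIntegral.integral_pos hL (hu.mul hu) (fun _ _ => mul_self_nonneg _)
    ⟨x, hx, mul_self_pos.2 hux⟩

/-! ### Solutions for large wave numbers -/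

/-- The kernel estimate behind all bounds below: `Q` is the integrable factor, `w` the bounded
one. -/
theorem abs_integral_mul_le {Q : ℝ → ℝ} (hQ : Integrable Q) {w : ℝ → ℝ} {x M : ℝ} (hx : 0 ≤ x)
    (hM : 0 ≤ M) (hw : ∀ t ∈ Icc 0 x, |w t| ≤ M) :
    |∫ t in (0 : ℝ)..x, w t * Q t| ≤ M * ∫ t, |Q t| := by
  have h1 : ‖∫ t in (0 : ℝ)..x, w t * Q t‖ ≤ ∫ t in (0 : ℝ)..x, M * |Q t| := by
    refine intervalIntegral.norm_integral_le_of_norm_le hx (Eventually.of_forall fun t ht => ?_)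
      (hQ.abs.const_mul M).intervalIntegrable
    rw [Real.norm_eq_abs, abs_mul]
    exact mul_le_mul_of_nonneg_right (hw t ⟨ht.1.le, ht.2⟩) (abs_nonneg _)
  refine h1.trans ?_
  rw [intervalIntegral.integral_const_mul, intervalIntegral.integral_of_le hx]
  exact mul_le_mul_of_nonneg_left
    (setIntegral_le_integral hQ.abs (Eventually.of_forall fun _ => abs_nonneg _)) hM

theorem intervalIntegrable_mul_of_continuous {Q w : ℝ → ℝ} (hQ : Integrable Q) (hw : Continuous w)
    (x y : ℝ) : IntervalIntegrable (fun t => w t * Q t) volume x y :=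
  hQ.intervalIntegrable.continuousOn_mul hw.continuousOn

theorem integral_sin_sub_mul {Q u : ℝ → ℝ} (hQ : Integrable Q) (hu : Continuous u) (k x : ℝ) :
    ∫ t in (0 : ℝ)..x, (Real.sin (k * (x - t)) * u t) * Q t =
      Real.sin (k * x) * (∫ t in (0 : ℝ)..x, (Real.cos (k * t) * u t) * Q t) -
        Real.cos (k * x) * ∫ t in (0 : ℝ)..x, (Real.sin (k * t) * u t) * Q t := by
  rw [← intervalIntegral.integral_const_mul, ← intervalIntegral.integral_const_mul,
    ← intervalIntegral.integral_sub
      ((intervalIntegrable_mul_of_continuous hQ (by fun_prop) _ _).const_mul _)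
      ((intervalIntegrable_mul_of_continuous hQ (by fun_prop) _ _).const_mul _)]
  apply intervalIntegral.integral_congr
  intro t _
  simp only [mul_sub, Real.sin_sub]
  ring

theorem integral_cos_sub_mul {Q u : ℝ → ℝ} (hQ : Integrable Q) (hu : Continuous u) (k x : ℝ) :
    ∫ t in (0 : ℝ)..x, (Real.cos (k * (x - t)) * u t) * Q t =
      Real.cos (k * x) * (∫ t in (0 : ℝ)..x, (Real.cos (k * t) * u t) * Q t) +
        Real.sin (k * x) * ∫ t in (0 : ℝ)..x, (Real.sin (k * t) * u t) * Q t := by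
  rw [← intervalIntegral.integral_const_mul, ← intervalIntegral.integral_const_mul,
    ← intervalIntegral.integral_add
      ((intervalIntegrable_mul_of_continuous hQ (by fun_prop) _ _).const_mul _)
      ((intervalIntegrable_mul_of_continuous hQ (by fun_prop) _ _).const_mul _)]
  apply intervalIntegral.integral_congr
  intro t _
  simp only [mul_sub, Real.cos_sub]
  ring

/-- The bound by which a contractive Volterra equation controls its own solution. -/
theorem abs_le_of_self_bound {L c : ℝ} (hL : 0 ≤ L) {w : ℝ → ℝ} (hw : ContinuousOn w (Icc 0 L))
    (h : ∀ M, 0 ≤ M → (∀ x ∈ Icc 0 L, |w x| ≤ M) → ∀ x ∈ Icc 0 L, |w x| ≤ c + M / 2) :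
    ∀ x ∈ Icc 0 L, |w x| ≤ 2 * c := by
  obtain ⟨x0, hx0, hmax⟩ := isCompact_Icc.exists_isMaxOn (nonempty_Icc.2 hL) hw.abs
  have h1 := h _ (abs_nonneg (w x0)) (fun x hx => hmax hx) x0 hx0
  intro x hx
  have h2 : |w x| ≤ |w x0| := hmax hx
  linarith

/-- For large `k` the integral equation equivalent to `-u'' + Q u = k² u`, `u(0) = p`,
`u'(0) = k r` is a contraction, hence has a solution. -/
theorem exists_volterra_solution {L : ℝ} (hL : 0 ≤ L) {Q : ℝ → ℝ} (hQ : Integrable Q) (p r : ℝ)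
    {k : ℝ} (hk : 2 * (∫ t, |Q t|) + 1 ≤ k) :
    ∃ u : ℝ → ℝ, Continuous u ∧ ∀ x ∈ Icc 0 L, u x = p * Real.cos (k * x) + r * Real.sin (k * x) +
      k⁻¹ * ∫ t in (0 : ℝ)..x, (Real.sin (k * (x - t)) * u t) * Q t := by
  have hN : 0 ≤ ∫ t, |Q t| := integral_nonneg fun _ => abs_nonneg _
  have hk0 : 0 < k := by linarith
  let E : C(Icc (0 : ℝ) L, ℝ) → ℝ → ℝ := fun f => IccExtend hL f
  have hE : ∀ f, Continuous (E f) := fun f => f.continuous.Icc_extend'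
  let T : C(Icc (0 : ℝ) L, ℝ) → ℝ → ℝ := fun f x =>
    p * Real.cos (k * x) + r * Real.sin (k * x) +
      k⁻¹ * ∫ t in (0 : ℝ)..x, (Real.sin (k * (x - t)) * E f t) * Q t
  have hT : ∀ f, Continuous (T f) := by
    intro f
    have h1 : Continuous fun x => ∫ t in (0 : ℝ)..x, (Real.cos (k * t) * E f t) * Q t :=
      intervalIntegral.continuous_primitive (fun a b => intervalIntegrable_mul_of_continuous hQ
        (by have := hE f; fun_prop) a b) 0
    have h2 : Continuous fun x => ∫ t in (0 : ℝ)..x, (Real.sin (k * t) * E f t) * Q t :=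
      intervalIntegral.continuous_primitive (fun a b => intervalIntegrable_mul_of_continuous hQ
        (by have := hE f; fun_prop) a b) 0
    have h3 : T f = fun x => p * Real.cos (k * x) + r * Real.sin (k * x) +
        k⁻¹ * (Real.sin (k * x) * (∫ t in (0 : ℝ)..x, (Real.cos (k * t) * E f t) * Q t) -
          Real.cos (k * x) * ∫ t in (0 : ℝ)..x, (Real.sin (k * t) * E f t) * Q t) := by
      funext x
      simp only [T]
      rw [integral_sin_sub_mul hQ (hE f)]
    rw [h3]
    fun_prop
  let F : C(Icc (0 : ℝ) L, ℝ) → C(Icc (0 : ℝ) L, ℝ) := fun f =>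
    ⟨fun x => T f x, (hT f).comp continuous_subtype_val⟩
  have hF : ContractingWith (1 / 2) F := by
    refine ⟨by rw [← NNReal.coe_lt_coe]; norm_num, LipschitzWith.of_dist_le_mul fun f g => ?_⟩
    rw [ContinuousMap.dist_le (by positivity)]
    rintro ⟨x, hx⟩
    have h1 : T f x - T g x =
        k⁻¹ * ∫ t in (0 : ℝ)..x, (Real.sin (k * (x - t)) * (E f t - E g t)) * Q t := by
      simp only [T]
      rw [add_sub_add_left_eq_sub, ← mul_sub, ← intervalIntegral.integral_sub]
      · congr 2
        funext t
        ring
      · exact intervalIntegrable_mul_of_continuous hQ (by have := hE f; fun_prop) _ _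
      · exact intervalIntegrable_mul_of_continuous hQ (by have := hE g; fun_prop) _ _
    have h2 := abs_integral_mul_le hQ (w := fun t => Real.sin (k * (x - t)) * (E f t - E g t))
      (x := x) (M := dist f g) hx.1 dist_nonneg (fun t _ => by
        rw [abs_mul]
        have h3 : |E f t - E g t| ≤ dist f g := by
          rw [← Real.dist_eq]
          exact ContinuousMap.dist_apply_le_dist _
        have h4 := Real.abs_sin_le_one (k * (x - t))
        nlinarith [abs_nonneg (E f t - E g t)])
    rw [Real.dist_eq]
    change |T f x - T g x| ≤ _
    rw [h1, abs_mul, abs_inv, abs_of_pos hk0]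
    have h5 : ((1 / 2 : NNReal) : ℝ) = 1 / 2 := by norm_num
    rw [h5, inv_mul_le_iff₀ hk0]
    have h6 := dist_nonneg (x := f) (y := g)
    nlinarith
  refine ⟨E (hF.fixedPoint F), hE _, fun x hx => ?_⟩
  have h := hF.fixedPoint_isFixedPt
  have h1 : E (hF.fixedPoint F) x = hF.fixedPoint F ⟨x, hx⟩ := IccExtend_of_mem hL _ hx
  rw [h1]
  conv_lhs => rw [← h.eq]
  rfl

/-- A continuous solution of the integral equation solves the differential equation, and its
derivative is given by the differentiated integral equation. -/
theorem isEdgeSolution_of_volterra {L : ℝ} {q Q : ℝ → ℝ} (hQ : Integrable Q)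
    (hqQ : ∀ x ∈ Icc 0 L, Q x = q x) (p r : ℝ) {k : ℝ} (hk : 0 < k) {u : ℝ → ℝ}
    (hu : Continuous u)
    (hvol : ∀ x ∈ Icc 0 L, u x = p * Real.cos (k * x) + r * Real.sin (k * x) +
      k⁻¹ * ∫ t in (0 : ℝ)..x, (Real.sin (k * (x - t)) * u t) * Q t) :
    IsEdgeSolution L q (k ^ 2) u (fun x => k * (-p * Real.sin (k * x) + r * Real.cos (k * x) +
      k⁻¹ * ∫ t in (0 : ℝ)..x, (Real.cos (k * (x - t)) * u t) * Q t)) := by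
  have hic : ∀ x y, IntervalIntegrable (fun t => (Real.cos (k * t) * u t) * Q t) volume x y :=
    intervalIntegrable_mul_of_continuous hQ (by fun_prop)
  have his : ∀ x y, IntervalIntegrable (fun t => (Real.sin (k * t) * u t) * Q t) volume x y :=
    intervalIntegrable_mul_of_continuous hQ (by fun_prop)
  set A : ℝ → ℝ := fun x => ∫ t in (0 : ℝ)..x, (Real.cos (k * t) * u t) * Q t with hA
  set B : ℝ → ℝ := fun x => ∫ t in (0 : ℝ)..x, (Real.sin (k * t) * u t) * Q t with hB
  have hAc : Continuous A := intervalIntegral.continuous_primitive hic 0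
  have hBc : Continuous B := intervalIntegral.continuous_primitive his 0
  have hAac : ∀ y, AbsolutelyContinuousOnInterval A 0 y := fun y =>
    (hic 0 y).absolutelyContinuousOnInterval_intervalIntegral left_mem_uIcc
  have hBac : ∀ y, AbsolutelyContinuousOnInterval B 0 y := fun y =>
    (his 0 y).absolutelyContinuousOnInterval_intervalIntegral left_mem_uIcc
  have hcac : ∀ y, AbsolutelyContinuousOnInterval (fun x => Real.cos (k * x)) 0 y := fun y =>
    ContDiffOn.absolutelyContinuousOnInterval (by fun_prop)
  have hsac : ∀ y, AbsolutelyContinuousOnInterval (fun x => Real.sin (k * x)) 0 y := fun y =>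
    ContDiffOn.absolutelyContinuousOnInterval (by fun_prop)
  have hS : ∀ x, ∫ t in (0 : ℝ)..x, (Real.sin (k * (x - t)) * u t) * Q t =
      Real.sin (k * x) * A x - Real.cos (k * x) * B x := integral_sin_sub_mul hQ hu k
  have hC : ∀ x, ∫ t in (0 : ℝ)..x, (Real.cos (k * (x - t)) * u t) * Q t =
      Real.cos (k * x) * A x + Real.sin (k * x) * B x := integral_cos_sub_mul hQ hu k
  simp only [hS] at hvol
  simp only [hC]
  set w : ℝ → ℝ := fun x => p * Real.cos (k * x) + r * Real.sin (k * x) +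
    k⁻¹ * (Real.sin (k * x) * A x - Real.cos (k * x) * B x) with hw
  set v : ℝ → ℝ := fun x => -p * Real.sin (k * x) + r * Real.cos (k * x) +
    k⁻¹ * (Real.cos (k * x) * A x + Real.sin (k * x) * B x) with hv
  have hwac : ∀ y, AbsolutelyContinuousOnInterval w 0 y := fun y =>
    (((hcac y).const_mul p).add ((hsac y).const_mul r)).add
      ((((hsac y).mul (hAac y)).sub ((hcac y).mul (hBac y))).const_mul k⁻¹)
  have hvac : ∀ y, AbsolutelyContinuousOnInterval v 0 y := fun y =>
    (((hsac y).const_mul (-p)).add ((hcac y).const_mul r)).add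
      ((((hcac y).mul (hAac y)).add ((hsac y).mul (hBac y))).const_mul k⁻¹)
  have hvc : Continuous v := by rw [hv]; fun_prop
  have hloc : LocallyIntegrable (fun t => (Real.cos (k * t) * u t) * Q t) :=
    hQ.locallyIntegrable.continuous_mul (by fun_prop)
  have hloc' : LocallyIntegrable (fun t => (Real.sin (k * t) * u t) * Q t) :=
    hQ.locallyIntegrable.continuous_mul (by fun_prop)
  have hcd : ∀ x, HasDerivAt (fun x => Real.cos (k * x)) (-(k * Real.sin (k * x))) x := fun x => by
    have := (Real.hasDerivAt_cos (k * x)).comp x ((hasDerivAt_id x).const_mul k)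
    convert! this using 1
    ring
  have hsd : ∀ x, HasDerivAt (fun x => Real.sin (k * x)) (k * Real.cos (k * x)) x := fun x => by
    have := (Real.hasDerivAt_sin (k * x)).comp x ((hasDerivAt_id x).const_mul k)
    convert! this using 1
    ring
  have hae : ∀ᵐ x, HasDerivAt w (k * v x) x ∧
      HasDerivAt v (-k * w x + k⁻¹ * (u x * Q x)) x := by
    filter_upwards [_root_.LocallyIntegrable.ae_hasDerivAt_integral hloc,
      _root_.LocallyIntegrable.ae_hasDerivAt_integral hloc'] with x h1 h2
    have hA' : HasDerivAt A (Real.cos (k * x) * u x * Q x) x := h1 0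
    have hB' : HasDerivAt B (Real.sin (k * x) * u x * Q x) x := h2 0
    constructor
    · have h := (((hcd x).const_mul p).add ((hsd x).const_mul r)).add
        ((((hsd x).mul hA').sub ((hcd x).mul hB')).const_mul k⁻¹)
      refine h.congr_deriv ?_
      simp only [hv]
      field_simp
      ring
    · have h := (((hsd x).const_mul (-p)).add ((hcd x).const_mul r)).add
        ((((hcd x).mul hA').add ((hsd x).mul hB')).const_mul k⁻¹)
      refine h.congr_deriv ?_
      simp only [hw]
      have h3 := Real.sin_sq_add_cos_sq (k * x)
      field_simp
      linear_combination (u x * Q x) * h3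
  -- `w` is absolutely continuous and has the continuous derivative `k * v` almost everywhere,
  -- so it has this derivative everywhere.
  have hwint : ∀ y, w y = w 0 + ∫ t in (0 : ℝ)..y, k * v t := by
    intro y
    have h1 := (hwac y).integral_deriv_eq_sub
    have h2 : ∫ t in (0 : ℝ)..y, deriv w t = ∫ t in (0 : ℝ)..y, k * v t := by
      apply intervalIntegral.integral_congr_ae
      filter_upwards [hae] with x hx _ using hx.1.deriv
    linarith
  have hwd : ∀ x, HasDerivAt w (k * v x) x := by
    intro x
    have hc : Continuous fun t => k * v t := by fun_prop
    have h1 := (intervalIntegral.integral_hasDerivAt_right (hc.intervalIntegrable 0 x)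
      (hc.stronglyMeasurableAtFilter _ _) hc.continuousAt).const_add (w 0)
    rw [show w = fun y => w 0 + ∫ t in (0 : ℝ)..y, k * v t from funext hwint]
    exact h1
  refine ⟨fun x hx => (hwd x).hasDerivWithinAt.congr hvol (hvol x hx), (hvac L).const_mul k, ?_⟩
  rw [ae_restrict_iff' measurableSet_Icc]
  filter_upwards [hae] with x hx hxL
  refine ⟨_, hx.2.const_mul k, ?_⟩
  have h1 : u x = w x := hvol x hxL
  rw [← h1, hqQ x hxL]
  field_simp
  ring

/-- A family of solutions of `-u'' + q u = k² u` on the edge `[0, L]`, indexed by the wave number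
`k ≥ Λ`: the solution `u k` has initial data `u(0) = p`, `u'(0) = k r`, and `v k` is its derivative
divided by `k`. The end point values are close to those of the free solution with the same data,
and the family is Lipschitz in `k`. -/
structure IsSolutionFamily (L : ℝ) (q : ℝ → ℝ) (p r Λ K : ℝ) (u v : ℝ → ℝ → ℝ) : Prop where
  sol : ∀ k, Λ ≤ k → IsEdgeSolution L q (k ^ 2) (u k) (fun x => k * v k x)
  init : ∀ k, Λ ≤ k → u k 0 = p
  init_deriv : ∀ k, Λ ≤ k → v k 0 = r
  asymp : ∀ k, Λ ≤ k → |u k L - (p * Real.cos (k * L) + r * Real.sin (k * L))| ≤ K / k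
  asymp_deriv : ∀ k, Λ ≤ k → |v k L - (-p * Real.sin (k * L) + r * Real.cos (k * L))| ≤ K / k
  lip : ∀ k k', Λ ≤ k → Λ ≤ k' → ∀ x ∈ Icc 0 L, |u k x - u k' x| ≤ K * |k - k'|
  lip_deriv : ∀ k k', Λ ≤ k → Λ ≤ k' → |v k L - v k' L| ≤ K * |k - k'|

theorem abs_sin_sub_sin_le (x y : ℝ) : |Real.sin x - Real.sin y| ≤ |x - y| := by
  have := Real.lipschitzWith_sin.dist_le_mul x y
  simpa [Real.dist_eq] using this

theorem abs_cos_sub_cos_le (x y : ℝ) : |Real.cos x - Real.cos y| ≤ |x - y| := by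
  have := Real.lipschitzWith_cos.dist_le_mul x y
  simpa [Real.dist_eq] using this

/-- The kernels `k⁻¹ sin (k y)` and `k⁻¹ cos (k y)` are Lipschitz in `k ≥ 1`; `f` stands for the
sine or the cosine. -/
theorem abs_inv_mul_sub_le {f : ℝ → ℝ} (hf : ∀ x, |f x| ≤ 1) (hf' : ∀ x y, |f x - f y| ≤ |x - y|)
    {k k' y L : ℝ} (hk : 1 ≤ k) (hk' : 1 ≤ k') (hy : |y| ≤ L) :
    |k⁻¹ * f (k * y) - k'⁻¹ * f (k' * y)| ≤ (L + 1) * |k - k'| := by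
  have h1 : k⁻¹ * f (k * y) - k'⁻¹ * f (k' * y) =
      k⁻¹ * (f (k * y) - f (k' * y)) + (k⁻¹ - k'⁻¹) * f (k' * y) := by ring
  have hki : |k⁻¹| ≤ 1 := by
    rw [abs_of_pos (by positivity)]; exact inv_le_one_of_one_le₀ hk
  have h2 : |k⁻¹ - k'⁻¹| ≤ |k - k'| := by
    rw [inv_sub_inv (by positivity) (by positivity), abs_div, abs_sub_comm]
    apply div_le_self (abs_nonneg _)
    rw [abs_of_pos (by positivity)]
    nlinarith
  have h3 : |f (k * y) - f (k' * y)| ≤ L * |k - k'| := by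
    refine (hf' _ _).trans ?_
    rw [← sub_mul, abs_mul, mul_comm]
    exact mul_le_mul_of_nonneg_right hy (abs_nonneg _)
  rw [h1]
  refine (abs_add_le _ _).trans ?_
  rw [abs_mul, abs_mul]
  have h4 : |k⁻¹| * |f (k * y) - f (k' * y)| ≤ 1 * (L * |k - k'|) :=
    mul_le_mul hki h3 (abs_nonneg _) zero_le_one
  have h5 : |k⁻¹ - k'⁻¹| * |f (k' * y)| ≤ |k - k'| * 1 :=
    mul_le_mul h2 (hf _) (abs_nonneg _) (abs_nonneg _)
  linarith

/-- The difference of two Volterra terms with kernels `k⁻¹ f (k y)` and `k'⁻¹ f (k' y)`. -/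
theorem abs_volterra_sub_le {L : ℝ} {Q : ℝ → ℝ} (hQ : Integrable Q) {f : ℝ → ℝ}
    (hfc : Continuous f) (hf : ∀ x, |f x| ≤ 1) (hf' : ∀ x y, |f x - f y| ≤ |x - y|)
    {k k' : ℝ} (hk : 2 * (∫ t, |Q t|) + 1 ≤ k) (hk' : 1 ≤ k') {u u' : ℝ → ℝ}
    (hu : Continuous u) (hu' : Continuous u') {C M : ℝ} (hC : 0 ≤ C) (hM : 0 ≤ M)
    (hu'C : ∀ x ∈ Icc 0 L, |u' x| ≤ C) (huM : ∀ x ∈ Icc 0 L, |u x - u' x| ≤ M)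
    {x : ℝ} (hx : x ∈ Icc 0 L) :
    |k⁻¹ * (∫ t in (0 : ℝ)..x, (f (k * (x - t)) * u t) * Q t) -
      k'⁻¹ * ∫ t in (0 : ℝ)..x, (f (k' * (x - t)) * u' t) * Q t| ≤
      M / 2 + (L + 1) * |k - k'| * C * ∫ t, |Q t| := by
  have hN : 0 ≤ ∫ t, |Q t| := integral_nonneg fun _ => abs_nonneg _
  have hk1 : 1 ≤ k := by linarith
  have hk0 : 0 < k := by linarith
  have hL : 0 ≤ L := hx.1.trans hx.2
  have hi : ∀ w : ℝ → ℝ, Continuous w → IntervalIntegrable (fun t => w t * Q t) volume 0 x :=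
    fun w hw => intervalIntegrable_mul_of_continuous hQ hw _ _
  have h1 : k⁻¹ * (∫ t in (0 : ℝ)..x, (f (k * (x - t)) * u t) * Q t) -
      k'⁻¹ * (∫ t in (0 : ℝ)..x, (f (k' * (x - t)) * u' t) * Q t) =
      k⁻¹ * (∫ t in (0 : ℝ)..x, (f (k * (x - t)) * (u t - u' t)) * Q t) +
      ∫ t in (0 : ℝ)..x,
        ((k⁻¹ * f (k * (x - t)) - k'⁻¹ * f (k' * (x - t))) * u' t) * Q t := by
    rw [← intervalIntegral.integral_const_mul, ← intervalIntegral.integral_const_mul,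
      ← intervalIntegral.integral_const_mul, ← intervalIntegral.integral_sub,
      ← intervalIntegral.integral_add]
    · congr 1
      funext t
      ring
    · exact (hi _ (by fun_prop)).const_mul _
    · exact hi _ (by fun_prop)
    · exact (hi _ (by fun_prop)).const_mul _
    · exact (hi _ (by fun_prop)).const_mul _
  have h2 := abs_integral_mul_le hQ (w := fun t => f (k * (x - t)) * (u t - u' t)) hx.1 hM
    (fun t ht => by
      rw [abs_mul]
      have h3 := huM t ⟨ht.1, ht.2.trans hx.2⟩
      have h4 := mul_le_mul (hf (k * (x - t))) h3 (abs_nonneg _) zero_le_one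
      linarith)
  have h5 := abs_integral_mul_le hQ
    (w := fun t => (k⁻¹ * f (k * (x - t)) - k'⁻¹ * f (k' * (x - t))) * u' t) hx.1
    (M := (L + 1) * |k - k'| * C) (by positivity)
    (fun t ht => by
      rw [abs_mul]
      refine mul_le_mul (abs_inv_mul_sub_le hf hf' hk1 hk' ?_) (hu'C t ⟨ht.1, ht.2.trans hx.2⟩)
        (abs_nonneg _) (by positivity)
      rw [abs_of_nonneg (by linarith [ht.2])]
      linarith [ht.1, hx.2])
  rw [h1]
  refine (abs_add_le _ _).trans (add_le_add ?_ h5)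
  rw [abs_mul, abs_inv, abs_of_pos hk0, inv_mul_le_iff₀ hk0]
  refine h2.trans ?_
  nlinarith

/-- Solution families exist for any data of size at most one. All bounds come from the integral
equation: for `k ≥ 2 ‖q‖₁ + 1` its integral term is at most half of the supremum norm. -/
theorem exists_solutionFamily {L : ℝ} (hL : 0 < L) {q : ℝ → ℝ}
    (hq : IntegrableOn q (Icc 0 L) volume) {p r : ℝ} (hp : |p| ≤ 1) (hr : |r| ≤ 1) :
    ∃ Λ K : ℝ, 1 ≤ Λ ∧ 0 ≤ K ∧ ∃ u v, IsSolutionFamily L q p r Λ K u v := by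
  set Q : ℝ → ℝ := (Icc 0 L).indicator q with hQdef
  have hQ : Integrable Q := hq.integrable_indicator measurableSet_Icc
  have hqQ : ∀ x ∈ Icc 0 L, Q x = q x := fun x hx => indicator_of_mem hx q
  set N : ℝ := ∫ t, |Q t| with hNdef
  have hN : 0 ≤ N := integral_nonneg fun _ => abs_nonneg _
  have hex : ∀ k, ∃ u : ℝ → ℝ, 2 * N + 1 ≤ k → Continuous u ∧ ∀ x ∈ Icc 0 L,
      u x = p * Real.cos (k * x) + r * Real.sin (k * x) +
        k⁻¹ * ∫ t in (0 : ℝ)..x, (Real.sin (k * (x - t)) * u t) * Q t := by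
    intro k
    by_cases hk : 2 * N + 1 ≤ k
    · obtain ⟨u, hu⟩ := exists_volterra_solution hL.le hQ p r hk
      exact ⟨u, fun _ => hu⟩
    · exact ⟨0, fun h => absurd h hk⟩
  choose u hu using hex
  have huc : ∀ k, 2 * N + 1 ≤ k → Continuous (u k) := fun k hk => (hu k hk).1
  have hvol := fun k hk => (hu k hk).2
  -- The a priori bound `|u| ≤ 4`.
  have hfree : ∀ y z : ℝ, |p * y + r * z| ≤ |y| + |z| := by
    intro y z
    refine (abs_add_le _ _).trans ?_
    rw [abs_mul, abs_mul]
    nlinarith [abs_nonneg y, abs_nonneg z]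
  have hbd : ∀ k, 2 * N + 1 ≤ k → ∀ x ∈ Icc 0 L, |u k x| ≤ 4 := by
    intro k hk
    have hk0 : 0 < k := by linarith
    have h := abs_le_of_self_bound hL.le (huc k hk).continuousOn (c := 2) (fun M hM hb x hx => by
      have h1 := abs_integral_mul_le hQ (w := fun t => Real.sin (k * (x - t)) * u k t) hx.1 hM
        (fun t ht => by
          rw [abs_mul]
          have h4 := mul_le_mul (Real.abs_sin_le_one (k * (x - t)))
            (hb t ⟨ht.1, ht.2.trans hx.2⟩) (abs_nonneg _) zero_le_one
          linarith)
      rw [hvol k hk x hx]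
      refine (abs_add_le _ _).trans (add_le_add ?_ ?_)
      · have h2 := hfree (Real.cos (k * x)) (Real.sin (k * x))
        have h3 := Real.abs_cos_le_one (k * x)
        have h4 := Real.abs_sin_le_one (k * x)
        linarith
      · rw [abs_mul, abs_inv, abs_of_pos hk0, inv_mul_le_iff₀ hk0]
        refine h1.trans ?_
        change M * N ≤ _
        nlinarith)
    intro x hx
    linarith [h x hx]
  set K₁ : ℝ := 2 * (2 * L + (L + 1) * 4 * N) with hK₁
  have hK₁0 : 0 ≤ K₁ := by positivity
  have hlip : ∀ k k', 2 * N + 1 ≤ k → 2 * N + 1 ≤ k' → ∀ x ∈ Icc 0 L,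
      |u k x - u k' x| ≤ K₁ * |k - k'| := by
    intro k k' hk hk'
    have h := abs_le_of_self_bound hL.le ((huc k hk).sub (huc k' hk')).continuousOn
      (c := (2 * L + (L + 1) * 4 * N) * |k - k'|) (fun M hM hb x hx => by
        have h1 := abs_volterra_sub_le hQ Real.continuous_sin Real.abs_sin_le_one
          abs_sin_sub_sin_le hk (show 1 ≤ k' by linarith) (huc k hk) (huc k' hk') (by norm_num) hM
          (hbd k' hk') hb hx
        have h2 := hfree (Real.cos (k * x) - Real.cos (k' * x))
          (Real.sin (k * x) - Real.sin (k' * x))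
        have h3 : |k * x - k' * x| ≤ L * |k - k'| := by
          rw [← sub_mul, abs_mul, mul_comm, abs_of_nonneg hx.1]
          exact mul_le_mul_of_nonneg_right hx.2 (abs_nonneg _)
        have h4 := (abs_cos_sub_cos_le _ _).trans h3
        have h5 := (abs_sin_sub_sin_le _ _).trans h3
        have h6 : (u k - u k') x = (p * (Real.cos (k * x) - Real.cos (k' * x)) +
            r * (Real.sin (k * x) - Real.sin (k' * x))) +
            (k⁻¹ * (∫ t in (0 : ℝ)..x, (Real.sin (k * (x - t)) * u k t) * Q t) -
            k'⁻¹ * ∫ t in (0 : ℝ)..x, (Real.sin (k' * (x - t)) * u k' t) * Q t) := by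
          rw [Pi.sub_apply, hvol k hk x hx, hvol k' hk' x hx]
          ring
        rw [h6]
        refine (abs_add_le _ _).trans ?_
        rw [← hNdef] at h1
        linarith)
    intro x hx
    have h7 := h x hx
    rw [Pi.sub_apply] at h7
    linarith
  set v : ℝ → ℝ → ℝ := fun k x => -p * Real.sin (k * x) + r * Real.cos (k * x) +
      k⁻¹ * ∫ t in (0 : ℝ)..x, (Real.cos (k * (x - t)) * u k t) * Q t with hv
  set K : ℝ := K₁ + (2 * L + (L + 1) * 4 * N) + 4 * N with hK
  have hL' : L ∈ Icc 0 L := ⟨hL.le, le_rfl⟩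
  have hrem : ∀ f : ℝ → ℝ, (∀ x, |f x| ≤ 1) → ∀ k, 2 * N + 1 ≤ k →
      |k⁻¹ * ∫ t in (0 : ℝ)..L, (f (k * (L - t)) * u k t) * Q t| ≤ K / k := by
    intro f hf k hk
    have hk0 : 0 < k := by linarith
    have h1 := abs_integral_mul_le hQ (w := fun t => f (k * (L - t)) * u k t) hL.le
      (M := 4) (by norm_num) (fun t ht => by
        rw [abs_mul]
        have h4 := mul_le_mul (hf (k * (L - t))) (hbd k hk t ht) (abs_nonneg _) zero_le_one
        linarith)
    rw [abs_mul, abs_inv, abs_of_pos hk0, inv_mul_eq_div]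
    gcongr
    refine h1.trans ?_
    rw [← hNdef, hK]
    have : 0 ≤ 2 * L + (L + 1) * 4 * N := by positivity
    linarith
  refine ⟨2 * N + 1, K, by linarith, by positivity, u, v, ⟨?_, ?_, ?_, ?_, ?_, ?_, ?_⟩⟩
  · intro k hk
    exact isEdgeSolution_of_volterra hQ hqQ p r (by linarith) (huc k hk) (hvol k hk)
  · intro k hk
    simp [hvol k hk 0 ⟨le_rfl, hL.le⟩]
  · intro k hk
    simp [hv]
  · intro k hk
    rw [hvol k hk L hL', add_sub_cancel_left]
    exact hrem _ Real.abs_sin_le_one k hk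
  · intro k hk
    simp only [hv]
    rw [add_sub_cancel_left]
    exact hrem _ Real.abs_cos_le_one k hk
  · intro k k' hk hk' x hx
    refine (hlip k k' hk hk' x hx).trans (mul_le_mul_of_nonneg_right ?_ (abs_nonneg _))
    have : 0 ≤ 2 * L + (L + 1) * 4 * N := by positivity
    linarith
  · intro k k' hk hk'
    have h1 := abs_volterra_sub_le hQ Real.continuous_cos Real.abs_cos_le_one
      abs_cos_sub_cos_le hk (show 1 ≤ k' by linarith) (huc k hk) (huc k' hk') (by norm_num)
      (mul_nonneg hK₁0 (abs_nonneg (k - k'))) (hbd k' hk') (hlip k k' hk hk') hL'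
    have h2 : |-p * (Real.sin (k * L) - Real.sin (k' * L)) +
        r * (Real.cos (k * L) - Real.cos (k' * L))| ≤
        |Real.sin (k * L) - Real.sin (k' * L)| + |Real.cos (k * L) - Real.cos (k' * L)| := by
      refine (abs_add_le _ _).trans ?_
      rw [abs_mul, abs_mul, abs_neg]
      nlinarith [abs_nonneg (Real.sin (k * L) - Real.sin (k' * L)),
        abs_nonneg (Real.cos (k * L) - Real.cos (k' * L))]
    have h3 : |k * L - k' * L| ≤ L * |k - k'| := by
      rw [← sub_mul, abs_mul, mul_comm, abs_of_pos hL]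
    have h4 := (abs_cos_sub_cos_le _ _).trans h3
    have h5 := (abs_sin_sub_sin_le _ _).trans h3
    have h6 : v k L - v k' L = (-p * (Real.sin (k * L) - Real.sin (k' * L)) +
        r * (Real.cos (k * L) - Real.cos (k' * L))) +
        (k⁻¹ * (∫ t in (0 : ℝ)..L, (Real.cos (k * (L - t)) * u k t) * Q t) -
        k'⁻¹ * ∫ t in (0 : ℝ)..L, (Real.cos (k' * (L - t)) * u k' t) * Q t) := by
      simp only [hv]
      ring
    rw [h6]
    refine (abs_add_le _ _).trans ?_
    rw [← hNdef] at h1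
    have h7 : 0 ≤ N * |k - k'| := by positivity
    have h8 : 0 ≤ K₁ * |k - k'| := by positivity
    simp only [hK]
    linarith

theorem IsSolutionFamily.mono {L : ℝ} {q : ℝ → ℝ} {p r Λ K Λ' K' : ℝ} {u v : ℝ → ℝ → ℝ}
    (h : IsSolutionFamily L q p r Λ K u v) (hΛ1 : 1 ≤ Λ) (hΛ : Λ ≤ Λ') (hK : K ≤ K') :
    IsSolutionFamily L q p r Λ' K' u v where
  sol k hk := h.sol k (hΛ.trans hk)
  init k hk := h.init k (hΛ.trans hk)
  init_deriv k hk := h.init_deriv k (hΛ.trans hk)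
  asymp k hk := (h.asymp k (hΛ.trans hk)).trans
    (div_le_div_of_nonneg_right hK (by linarith))
  asymp_deriv k hk := (h.asymp_deriv k (hΛ.trans hk)).trans
    (div_le_div_of_nonneg_right hK (by linarith))
  lip k k' hk hk' x hx := (h.lip k k' (hΛ.trans hk) (hΛ.trans hk') x hx).trans
    (mul_le_mul_of_nonneg_right hK (abs_nonneg _))
  lip_deriv k k' hk hk' := (h.lip_deriv k k' (hΛ.trans hk) (hΛ.trans hk')).trans
    (mul_le_mul_of_nonneg_right hK (abs_nonneg _))

theorem IsSolutionFamily.continuousOn {L : ℝ} (hL : 0 ≤ L) {q : ℝ → ℝ} {p r Λ K : ℝ}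
    {u v : ℝ → ℝ → ℝ} (h : IsSolutionFamily L q p r Λ K u v) (hK : 0 ≤ K) :
    ContinuousOn (fun k => u k L) (Ici Λ) :=
  (LipschitzOnWith.of_dist_le_mul (K := ⟨K, hK⟩) fun k hk k' hk' =>
    h.lip k k' hk hk' L ⟨hL, le_rfl⟩).continuousOn

theorem IsSolutionFamily.continuousOn_deriv {L : ℝ} {q : ℝ → ℝ} {p r Λ K : ℝ}
    {u v : ℝ → ℝ → ℝ} (h : IsSolutionFamily L q p r Λ K u v) (hK : 0 ≤ K) :
    ContinuousOn (fun k => v k L) (Ici Λ) :=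
  (LipschitzOnWith.of_dist_le_mul (K := ⟨K, hK⟩) fun k hk k' hk' =>
    h.lip_deriv k k' hk hk').continuousOn

/-- Along wave numbers tending to infinity, the end point values have the limits of the free
ones. -/
theorem IsSolutionFamily.tendsto {L : ℝ} {q : ℝ → ℝ} {p r Λ K : ℝ} {u v : ℝ → ℝ → ℝ}
    (h : IsSolutionFamily L q p r Λ K u v) {x : ℕ → ℝ} {A B : ℝ} (hx : Tendsto x atTop atTop)
    (hA : Tendsto (fun n => Real.cos (x n * L)) atTop (𝓝 A))
    (hB : Tendsto (fun n => Real.sin (x n * L)) atTop (𝓝 B)) :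
    Tendsto (fun n => u (x n) L) atTop (𝓝 (p * A + r * B)) ∧
      Tendsto (fun n => v (x n) L) atTop (𝓝 (-p * B + r * A)) := by
  have h0 : Tendsto (fun n => K / x n) atTop (𝓝 0) := hx.const_div_atTop K
  have hev : ∀ᶠ n in atTop, Λ ≤ x n := hx.eventually_ge_atTop Λ
  constructor
  · have h1 : Tendsto (fun n => u (x n) L -
        (p * Real.cos (x n * L) + r * Real.sin (x n * L))) atTop (𝓝 0) :=
      squeeze_zero_norm' (hev.mono fun n hn => h.asymp _ hn) h0
    simpa using h1.add ((hA.const_mul p).add (hB.const_mul r))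
  · have h1 : Tendsto (fun n => v (x n) L -
        (-p * Real.sin (x n * L) + r * Real.cos (x n * L))) atTop (𝓝 0) :=
      squeeze_zero_norm' (hev.mono fun n hn => h.asymp_deriv _ hn) h0
    simpa using h1.add ((hB.const_mul (-p)).add (hA.const_mul r))

/-! ### The characteristic function of the lasso -/

/-- The characteristic function of the lasso at wave number `k`. Here `u` is the Neumann solution
on the edge and `v` its scaled derivative, `c` and `s` are the cosine- and sine-type solutions on
the ring, and `s'` is the scaled derivative of `s`. -/
def lassoChar (l a : ℝ) (u v c s s' : ℝ → ℝ → ℝ) (k : ℝ) : ℝ :=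
  (2 - c k a - s' k a) * u k l - s k a * v k l

/-- The monodromy matrix of the ring has determinant one. -/
theorem wronskian_eq_one {a : ℝ} (ha : 0 < a) {q : ℝ → ℝ} {Λ K : ℝ} (hΛ : 1 ≤ Λ)
    {c c' s s' : ℝ → ℝ → ℝ} (hc : IsSolutionFamily a q 1 0 Λ K c c')
    (hs : IsSolutionFamily a q 0 1 Λ K s s') {k : ℝ} (hk : Λ ≤ k) :
    c k a * s' k a - c' k a * s k a = 1 := by
  have h := (hc.sol k hk).lagrange ha.le (hs.sol k hk)
  simp only [hc.init k hk, hs.init k hk, hc.init_deriv k hk, hs.init_deriv k hk, sub_self,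
    zero_mul] at h
  have hk0 : k ≠ 0 := by linarith
  apply mul_left_cancel₀ hk0
  linear_combination h

theorem sine_solution_norm_pos {a : ℝ} (ha : 0 < a) {q : ℝ → ℝ} {Λ K : ℝ} (hΛ : 1 ≤ Λ)
    {s s' : ℝ → ℝ → ℝ} (hs : IsSolutionFamily a q 0 1 Λ K s s') {k : ℝ} (hk : Λ ≤ k) :
    (∃ x ∈ Icc 0 a, s k x ≠ 0) ∧ 0 < ∫ x in (0 : ℝ)..a, s k x * s k x := by
  have h1 : ∃ x ∈ Icc 0 a, s k x ≠ 0 := by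
    by_contra! hcon
    have h := (hs.sol k hk).deriv_eq_zero ha hcon (left_mem_Icc.2 ha.le)
    rw [hs.init_deriv k hk, mul_one] at h
    linarith
  obtain ⟨x, hx, hx'⟩ := h1
  exact ⟨⟨x, hx, hx'⟩, integral_mul_self_pos ha (hs.sol k hk).continuousOn hx hx'⟩

/-- At a Dirichlet wave number `ν` of the ring, the difference quotients of `s k a` converge: the
Lagrange identity gives the limit as a multiple of an `L²` norm, hence it is positive. -/
theorem tendsto_sine_quotient {a : ℝ} (ha : 0 < a) {q : ℝ → ℝ} {Λ K : ℝ} (hΛ : 1 ≤ Λ)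
    {s s' : ℝ → ℝ → ℝ} (hs : IsSolutionFamily a q 0 1 Λ K s s') {ν : ℝ} (hν : Λ < ν)
    (h0 : s ν a = 0) (h1 : s' ν a = 1) :
    Tendsto (fun k => s k a / (k - ν)) (𝓝[≠] ν)
      (𝓝 (2 * ∫ x in (0 : ℝ)..a, s ν x * s ν x)) := by
  have hν0 : 0 < ν := by linarith
  have hev : ∀ᶠ k in 𝓝[≠] ν, Λ ≤ k := nhdsWithin_le_nhds (Ici_mem_nhds hν)
  set I : ℝ → ℝ := fun k => ∫ x in (0 : ℝ)..a, s k x * s ν x with hI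
  have hcont : ∀ k, Λ ≤ k → ContinuousOn (s k) (uIcc 0 a) := fun k hk => by
    rw [uIcc_of_le ha.le]; exact (hs.sol k hk).continuousOn
  have hItend : Tendsto I (𝓝[≠] ν) (𝓝 (I ν)) := by
    have hdiff : ∀ᶠ k in 𝓝[≠] ν, ‖I k - I ν‖ ≤ K * |k - ν| * ∫ x in (0 : ℝ)..a, |s ν x| := by
      filter_upwards [hev] with k hk
      have hi1 : IntervalIntegrable (fun x => s k x * s ν x) volume 0 a :=
        ((hcont k hk).mul (hcont ν hν.le)).intervalIntegrable
      have hi2 : IntervalIntegrable (fun x => s ν x * s ν x) volume 0 a :=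
        ((hcont ν hν.le).mul (hcont ν hν.le)).intervalIntegrable
      simp only [hI]
      rw [← intervalIntegral.integral_sub hi1 hi2, ← intervalIntegral.integral_const_mul]
      refine intervalIntegral.norm_integral_le_of_norm_le ha.le
        (Eventually.of_forall fun x hx => ?_) ?_
      · rw [← sub_mul, norm_mul, Real.norm_eq_abs, Real.norm_eq_abs]
        exact mul_le_mul_of_nonneg_right (hs.lip k ν hk hν.le x ⟨hx.1.le, hx.2⟩) (abs_nonneg _)
      · exact ((hcont ν hν.le).abs.const_smul (K * |k - ν|)).intervalIntegrable
    have hz : Tendsto (fun k => K * |k - ν| * ∫ x in (0 : ℝ)..a, |s ν x|) (𝓝[≠] ν) (𝓝 0) := by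
      have hc : Continuous fun k => K * |k - ν| * ∫ x in (0 : ℝ)..a, |s ν x| := by fun_prop
      have := hc.tendsto ν
      simp only [sub_self, abs_zero, mul_zero, zero_mul] at this
      exact this.mono_left nhdsWithin_le_nhds
    simpa using (squeeze_zero_norm' hdiff hz).add_const (I ν)
  have hfac : Tendsto (fun k => (k + ν) / ν) (𝓝[≠] ν) (𝓝 2) := by
    have hc : Continuous fun k : ℝ => (k + ν) / ν := by fun_prop
    have := hc.tendsto ν
    rw [show (ν + ν) / ν = 2 by field_simp; norm_num] at this
    exact this.mono_left nhdsWithin_le_nhds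
  refine (hfac.mul hItend).congr' ?_
  filter_upwards [hev, self_mem_nhdsWithin] with k hk hkν
  have hkν' : k - ν ≠ 0 := sub_ne_zero.2 hkν
  have h := (hs.sol k hk).lagrange ha.le (hs.sol ν hν.le)
  simp only [hs.init k hk, hs.init ν hν.le, h0, h1, zero_mul, mul_zero, sub_zero, mul_one] at h
  rw [div_mul_eq_mul_div, div_eq_div_iff hν0.ne' hkν']
  linear_combination -h

/-- At a point where the monodromy matrix of the ring has diagonal `1, 1` and Dirichlet entry
`s = 0`, the characteristic function has a critical point only if the remaining double eigenvalue
condition holds. -/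
theorem hasDerivAt_lassoChar {l a : ℝ} (hl : 0 < l) (ha : 0 < a) {q₁ q₂ : ℝ → ℝ} {Λ K : ℝ}
    (hΛ : 1 ≤ Λ) (hK : 0 ≤ K) {u v c c' s s' : ℝ → ℝ → ℝ}
    (hu : IsSolutionFamily l q₁ 1 0 Λ K u v) (hc : IsSolutionFamily a q₂ 1 0 Λ K c c')
    (hs : IsSolutionFamily a q₂ 0 1 Λ K s s') {ν : ℝ} (hν : Λ < ν)
    (h0 : s ν a = 0) (hc1 : c ν a = 1) (h1 : s' ν a = 1) :
    HasDerivAt (lassoChar l a u v c s s')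
      (-(2 * (∫ x in (0 : ℝ)..a, s ν x * s ν x) * (c' ν a * u ν l + v ν l))) ν := by
  have hmem : Ici Λ ∈ 𝓝 ν := Ici_mem_nhds hν
  have hev : ∀ᶠ k in 𝓝[≠] ν, Λ ≤ k := nhdsWithin_le_nhds hmem
  have hcu : Tendsto (fun k => u k l) (𝓝[≠] ν) (𝓝 (u ν l)) :=
    ((hu.continuousOn hl.le hK).continuousAt hmem).tendsto.mono_left nhdsWithin_le_nhds
  have hcv : Tendsto (fun k => v k l) (𝓝[≠] ν) (𝓝 (v ν l)) :=
    ((hu.continuousOn_deriv hK).continuousAt hmem).tendsto.mono_left nhdsWithin_le_nhds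
  have hcc : Tendsto (fun k => c' k a) (𝓝[≠] ν) (𝓝 (c' ν a)) :=
    ((hc.continuousOn_deriv hK).continuousAt hmem).tendsto.mono_left nhdsWithin_le_nhds
  have hcs : Tendsto (fun k => s' k a) (𝓝[≠] ν) (𝓝 (s' ν a)) :=
    ((hs.continuousOn_deriv hK).continuousAt hmem).tendsto.mono_left nhdsWithin_le_nhds
  -- By the Wronskian identity the characteristic function is `(c - 1) (s' - 1) u - s (c' u + v)`
  -- with all values taken at the end points. The first term is of second order at `ν`.
  have hfirst : Tendsto (fun k => (c k a - 1) / (k - ν) * ((s' k a - 1) * u k l)) (𝓝[≠] ν)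
      (𝓝 0) := by
    have hz : Tendsto (fun k => K * ‖(s' k a - 1) * u k l‖) (𝓝[≠] ν) (𝓝 0) := by
      have := (((hcs.sub_const 1).mul hcu).norm).const_mul K
      simpa [h1] using this
    refine squeeze_zero_norm' ?_ hz
    filter_upwards [hev, self_mem_nhdsWithin] with k hk hkν
    rw [norm_mul]
    refine mul_le_mul_of_nonneg_right ?_ (norm_nonneg _)
    have h2 := hc.lip k ν hk hν.le a ⟨ha.le, le_rfl⟩
    rw [hc1] at h2
    rw [Real.norm_eq_abs, abs_div, div_le_iff₀ (abs_pos.2 (sub_ne_zero.2 hkν))]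
    exact h2
  have hsecond := (tendsto_sine_quotient ha hΛ hs hν h0 h1).mul ((hcc.mul hcu).add hcv)
  rw [hasDerivAt_iff_tendsto_slope]
  have hlim := hfirst.sub hsecond
  rw [zero_sub] at hlim
  refine hlim.congr' ?_
  filter_upwards [hev, self_mem_nhdsWithin] with k hk hkν
  have hkν' : k - ν ≠ 0 := sub_ne_zero.2 hkν
  have hw := wronskian_eq_one ha hΛ hc hs hk
  rw [slope_def_field]
  simp only [lassoChar, h0, hc1, h1]
  field_simp
  linear_combination u k l * hw

/-! ### Resonant wave numbers -/

/-- By Dirichlet's approximation theorem there are arbitrarily large `b` with `b a ∈ 2πℤ` and `b l`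
arbitrarily close to `2πℤ`. -/
theorem exists_resonant_seq (l : ℝ) {a : ℝ} (ha : 0 < a) :
    ∃ b θ : ℕ → ℝ, Tendsto b atTop atTop ∧ Tendsto θ atTop (𝓝 0) ∧
      (∀ n y, Real.cos (b n * a + y) = Real.cos y ∧ Real.sin (b n * a + y) = Real.sin y) ∧
      ∀ n y, Real.cos (b n * l + y) = Real.cos (θ n + y) ∧
        Real.sin (b n * l + y) = Real.sin (θ n + y) := by
  have h := fun n : ℕ =>
    Real.exists_nat_abs_mul_sub_round_le ((n + 1 : ℕ) * l / a) (n := n + 1) n.succ_pos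
  choose j hj0 hjn hj using h
  have hpi := Real.pi_pos
  refine ⟨fun n => 2 * Real.pi * (j n * (n + 1 : ℕ)) / a,
    fun n => 2 * Real.pi *
      (j n * ((n + 1 : ℕ) * l / a) - round ((j n : ℝ) * ((n + 1 : ℕ) * l / a))), ?_, ?_, ?_, ?_⟩
  · have h1 : Tendsto (fun n : ℕ => (2 * Real.pi / a) * (n : ℝ)) atTop atTop :=
      tendsto_natCast_atTop_atTop.const_mul_atTop (by positivity)
    refine tendsto_atTop_mono (fun n => ?_) h1
    have h2 : (1 : ℝ) ≤ j n := by exact_mod_cast hj0 n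
    rw [div_mul_eq_mul_div]
    gcongr
    push_cast
    nlinarith [(Nat.cast_nonneg n : (0 : ℝ) ≤ n)]
  · have h1 : Tendsto (fun n : ℕ => 2 * Real.pi * (1 / ((n : ℝ) + 1))) atTop (𝓝 0) := by
      simpa using tendsto_one_div_add_atTop_nhds_zero_nat.const_mul (2 * Real.pi)
    refine squeeze_zero_norm (fun n => ?_) h1
    rw [norm_mul, Real.norm_of_nonneg (by positivity)]
    gcongr
    refine (hj n).trans ?_
    push_cast
    gcongr
    linarith
  · intro n y
    have h1 : 2 * Real.pi * (j n * (n + 1 : ℕ)) / a * a + y =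
        y + (j n * (n + 1) : ℕ) * (2 * Real.pi) := by
      push_cast
      field_simp
      ring
    simp only [h1, Real.cos_add_nat_mul_two_pi, Real.sin_add_nat_mul_two_pi, and_self]
  · intro n y
    set m : ℤ := round ((j n : ℝ) * ((n + 1 : ℕ) * l / a))
    have h1 : 2 * Real.pi * (j n * (n + 1 : ℕ)) / a * l + y =
        (2 * Real.pi * (j n * ((n + 1 : ℕ) * l / a) - m) + y) + m * (2 * Real.pi) := by
      field_simp
      ring
    simp only [h1, Real.cos_add_int_mul_two_pi, Real.sin_add_int_mul_two_pi]
    exact ⟨rfl, rfl⟩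

theorem cos_pos_of_abs_le {x : ℝ} (hx : |x| ≤ 5 / 4) : 1 / 5 < Real.cos x := by
  have h1 := Real.one_sub_sq_div_two_le_cos (x := x)
  have h2 := abs_le.1 hx
  nlinarith

/-- In every small window around suitable arbitrarily large wave numbers, either the algebraic
conditions for a double eigenvalue hold at some point, or the characteristic function has two
zeros. -/
theorem double_or_two_zeros {l a : ℝ} (hl : 0 < l) (ha : 0 < a) {q₁ q₂ : ℝ → ℝ} {Λ K : ℝ}
    (hΛ : 1 ≤ Λ) (hK : 0 ≤ K) {u v c c' s s' : ℝ → ℝ → ℝ}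
    (hu : IsSolutionFamily l q₁ 1 0 Λ K u v) (hc : IsSolutionFamily a q₂ 1 0 Λ K c c')
    (hs : IsSolutionFamily a q₂ 0 1 Λ K s s') {ε : ℝ} (hε : 0 < ε) (M : ℝ) :
    (∃ ν, Λ ≤ ν ∧ M ≤ ν ∧ s ν a = 0 ∧ c ν a = 1 ∧ s' ν a = 1 ∧
      c' ν a * u ν l + v ν l = 0) ∨
    ∃ k k', Λ ≤ k ∧ M ≤ k ∧ k < k' ∧ k' - k < ε ∧ lassoChar l a u v c s s' k = 0 ∧
      lassoChar l a u v c s s' k' = 0 ∧ 0 < u k l ∧ 0 < u k' l := by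
  obtain ⟨δ, hδ0, hδε, hδl, hδa⟩ : ∃ δ : ℝ, 0 < δ ∧ 2 * δ < ε ∧ δ * l ≤ 1 ∧ δ * a ≤ 1 := by
    refine ⟨min (ε / 3) (min (1 / l) (1 / a)), by positivity, ?_, ?_, ?_⟩
    · linarith [min_le_left (ε / 3) (min (1 / l) (1 / a))]
    · rw [← le_div_iff₀ hl]
      exact (min_le_right _ _).trans (min_le_left _ _)
    · rw [← le_div_iff₀ ha]
      exact (min_le_right _ _).trans (min_le_right _ _)
  obtain ⟨b, θ, hb, hθ, hba, hbl⟩ := exists_resonant_seq l ha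
  -- Limits of the end point values at a fixed offset `τ` from the resonant wave numbers.
  have hlim : ∀ τ : ℝ, Tendsto (fun n => s (b n + τ) a) atTop (𝓝 (Real.sin (τ * a))) ∧
      Tendsto (fun n => lassoChar l a u v c s s' (b n + τ)) atTop
        (𝓝 ((2 - 2 * Real.cos (τ * a)) * Real.cos (τ * l) +
          Real.sin (τ * a) * Real.sin (τ * l))) := by
    intro τ
    have hx : Tendsto (fun n => b n + τ) atTop atTop := tendsto_atTop_add_const_right _ _ hb
    have hθ' : Tendsto (fun n => θ n + τ * l) atTop (𝓝 (τ * l)) := by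
      simpa using hθ.add_const (τ * l)
    have h1 : Tendsto (fun n => Real.cos ((b n + τ) * l)) atTop (𝓝 (Real.cos (τ * l))) := by
      simp only [add_mul, (hbl _ _).1]
      exact (Real.continuous_cos.tendsto _).comp hθ'
    have h2 : Tendsto (fun n => Real.sin ((b n + τ) * l)) atTop (𝓝 (Real.sin (τ * l))) := by
      simp only [add_mul, (hbl _ _).2]
      exact (Real.continuous_sin.tendsto _).comp hθ'
    have h3 : Tendsto (fun n => Real.cos ((b n + τ) * a)) atTop (𝓝 (Real.cos (τ * a))) := by
      simp only [add_mul, (hba _ _).1]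
      exact tendsto_const_nhds
    have h4 : Tendsto (fun n => Real.sin ((b n + τ) * a)) atTop (𝓝 (Real.sin (τ * a))) := by
      simp only [add_mul, (hba _ _).2]
      exact tendsto_const_nhds
    obtain ⟨hu1, hu2⟩ := hu.tendsto hx h1 h2
    obtain ⟨hc1, -⟩ := hc.tendsto hx h3 h4
    obtain ⟨hs1, hs2⟩ := hs.tendsto hx h3 h4
    refine ⟨by simpa using hs1, ?_⟩
    have h := (((hc1.const_sub 2).sub hs2).mul hu1).sub (hs1.mul hu2)
    convert! h using 2
    ring
  have hla : 0 < δ * a := by positivity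
  have hll : 0 < δ * l := by positivity
  have hpi := Real.pi_gt_three
  have hsa : 0 < Real.sin (δ * a) := Real.sin_pos_of_pos_of_lt_pi hla (by linarith)
  have hsl : 0 < Real.sin (δ * l) := Real.sin_pos_of_pos_of_lt_pi hll (by linarith)
  have hcl : 1 / 5 < Real.cos (δ * l) := cos_pos_of_abs_le (by rw [abs_of_pos hll]; linarith)
  have hpos : 0 < (2 - 2 * Real.cos (δ * a)) * Real.cos (δ * l) +
      Real.sin (δ * a) * Real.sin (δ * l) := by
    have h1 : 0 ≤ (2 - 2 * Real.cos (δ * a)) * Real.cos (δ * l) :=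
      mul_nonneg (by linarith [Real.cos_le_one (δ * a)]) (by linarith)
    have h2 := mul_pos hsa hsl
    linarith
  have e1 := (hlim δ).1.eventually (lt_mem_nhds hsa)
  have e2 := (hlim δ).2.eventually (lt_mem_nhds hpos)
  have e3 : ∀ᶠ n in atTop, s (b n + -δ) a < 0 :=
    (hlim (-δ)).1.eventually (gt_mem_nhds (by rw [neg_mul, Real.sin_neg]; linarith))
  have e4 : ∀ᶠ n in atTop, 0 < lassoChar l a u v c s s' (b n + -δ) :=
    (hlim (-δ)).2.eventually (lt_mem_nhds (by
      simp only [neg_mul, Real.sin_neg, Real.cos_neg]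
      linarith))
  have e5 : ∀ᶠ n in atTop, |θ n| < 1 / 4 := by
    have := hθ.abs
    rw [abs_zero] at this
    exact this.eventually (gt_mem_nhds (by norm_num))
  have e6 := hb.eventually_ge_atTop (max (Λ + 1) (max M (5 * K)) + δ)
  obtain ⟨n, h1, h2, h3, h4, h5, h6⟩ :=
    (e1.and (e2.and (e3.and (e4.and (e5.and e6))))).exists
  set B := b n with hB
  rw [← sub_eq_add_neg] at h3 h4
  have hwin : ∀ k ∈ Icc (B - δ) (B + δ), Λ < k ∧ M ≤ k ∧ 5 * K ≤ k := by
    intro k hk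
    have m1 := le_max_left (Λ + 1) (max M (5 * K))
    have m2 := le_max_right (Λ + 1) (max M (5 * K))
    have m3 := le_max_left M (5 * K)
    have m4 := le_max_right M (5 * K)
    have := hk.1
    refine ⟨?_, ?_, ?_⟩ <;> linarith
  -- Throughout the window `c k a` and `u k l` are positive, being close to `1`.
  have hposw : ∀ k ∈ Icc (B - δ) (B + δ), 0 < u k l ∧ 0 < c k a := by
    intro k hk
    obtain ⟨k1, k2, k3⟩ := hwin k hk
    have hk0 : 0 < k := by linarith
    have herr : K / k ≤ 1 / 5 := by
      rw [div_le_iff₀ hk0]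
      linarith
    have hkB : |k - B| ≤ δ := abs_le.2 ⟨by linarith [hk.1], by linarith [hk.2]⟩
    have m1 := hu.asymp k k1.le
    have m2 := hc.asymp k k1.le
    have m3 : 1 / 5 < Real.cos (k * l) := by
      rw [show k * l = B * l + (k - B) * l by ring, (hbl n _).1]
      apply cos_pos_of_abs_le
      refine (abs_add_le _ _).trans ?_
      rw [abs_mul, abs_of_pos hl]
      nlinarith
    have m4 : 1 / 5 < Real.cos (k * a) := by
      rw [show k * a = B * a + (k - B) * a by ring, (hba n _).1]
      apply cos_pos_of_abs_le
      rw [abs_mul, abs_of_pos ha]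
      nlinarith
    have m5 := (abs_le.1 m1).1
    have m6 := (abs_le.1 m2).1
    constructor <;> linarith
  have hsub : Icc (B - δ) (B + δ) ⊆ Ici Λ := fun k hk => (hwin k hk).1.le
  have hcontS : ContinuousOn (fun k => s k a) (Icc (B - δ) (B + δ)) :=
    (hs.continuousOn ha.le hK).mono hsub
  have hcontD : ContinuousOn (lassoChar l a u v c s s') (Icc (B - δ) (B + δ)) :=
    (((continuousOn_const.sub (hc.continuousOn ha.le hK)).sub (hs.continuousOn_deriv hK)).mul
      (hu.continuousOn hl.le hK)).sub
      ((hs.continuousOn ha.le hK).mul (hu.continuousOn_deriv hK)) |>.mono hsub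
  by_cases hneg : ∃ κ ∈ Icc (B - δ) (B + δ), lassoChar l a u v c s s' κ < 0
  · right
    obtain ⟨κ, hκ, hκneg⟩ := hneg
    obtain ⟨k, hk, hk0⟩ := intermediate_value_Icc' hκ.1
      (hcontD.mono (Icc_subset_Icc le_rfl hκ.2)) ⟨hκneg.le, h4.le⟩
    obtain ⟨k', hk', hk'0⟩ := intermediate_value_Icc hκ.2
      (hcontD.mono (Icc_subset_Icc hκ.1 le_rfl)) ⟨hκneg.le, h2.le⟩
    have hkκ : k < κ := lt_of_le_of_ne hk.2 (by rintro rfl; linarith)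
    have hkw : k ∈ Icc (B - δ) (B + δ) := ⟨hk.1, hk.2.trans hκ.2⟩
    have hk'w : k' ∈ Icc (B - δ) (B + δ) := ⟨hκ.1.trans hk'.1, hk'.2⟩
    exact ⟨k, k', (hwin k hkw).1.le, (hwin k hkw).2.1, hkκ.trans_le hk'.1,
      by linarith [hkw.1, hk'w.2], hk0, hk'0, (hposw k hkw).1, (hposw k' hk'w).1⟩
  · left
    push Not at hneg
    obtain ⟨ν, hν, hν0⟩ := intermediate_value_Icc (by linarith : B - δ ≤ B + δ) hcontS
      ⟨h3.le, h1.le⟩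
    simp only at hν0
    obtain ⟨n1, n2, -⟩ := hwin ν hν
    obtain ⟨hup, hcp⟩ := hposw ν hν
    have hw := wronskian_eq_one ha hΛ hc hs n1.le
    rw [hν0, mul_zero, sub_zero] at hw
    -- Since `c s' = 1` with `c > 0`, the trace `c + s'` is at least `2`.
    have htr : c ν a + s' ν a = 2 + (c ν a - 1) ^ 2 * s' ν a := by
      linear_combination (2 - c ν a) * hw
    have hs'p : 0 < s' ν a := by
      by_contra! hcon
      nlinarith
    have hD : lassoChar l a u v c s s' ν = -((c ν a - 1) ^ 2 * s' ν a * u ν l) := by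
      simp only [lassoChar, hν0]
      linear_combination -u ν l * htr
    have hD0 := hneg ν hν
    have hprod : (c ν a - 1) ^ 2 * s' ν a * u ν l = 0 := by
      have : 0 ≤ (c ν a - 1) ^ 2 * s' ν a * u ν l := by positivity
      linarith
    have hc1 : c ν a = 1 := by
      have h := mul_eq_zero.1 ((mul_eq_zero.1 hprod).resolve_right hup.ne')
      have h' := h.resolve_right hs'p.ne'
      linarith [pow_eq_zero_iff (two_ne_zero) |>.1 h']
    have hs1 : s' ν a = 1 := by rw [hc1] at hw; linarith
    rw [hprod, neg_zero] at hD
    have hν1 : B - δ < ν := lt_of_le_of_ne hν.1 (by rintro rfl; linarith)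
    have hν2 : ν < B + δ := lt_of_le_of_ne hν.2 (by rintro rfl; linarith)
    have hmin : IsLocalMin (lassoChar l a u v c s s') ν := by
      filter_upwards [Icc_mem_nhds hν1 hν2] with k hk
      rw [hD]
      exact hneg k hk
    have hder := hmin.hasDerivAt_eq_zero
      (hasDerivAt_lassoChar hl ha hΛ hK hu hc hs n1 hν0 hc1 hs1)
    have hI := (sine_solution_norm_pos ha hΛ hs n1.le).2
    refine ⟨ν, n1.le, n2, hν0, hc1, hs1, ?_⟩
    have h7 := (mul_eq_zero.1 (neg_eq_zero.1 hder)).resolve_left (by positivity)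
    exact h7

/-! ### Eigenspaces -/

theorem IsLassoSolution.mem_eigenspace {l a : ℝ} {q₁ q₂ : ℝ → ℝ} {μ : ℝ}
    {u₁ du₁ u₂ du₂ : ℝ → ℝ} (h : IsLassoSolution l a q₁ q₂ μ u₁ du₁ u₂ du₂) :
    ((fun x => u₁ x, fun x => u₂ x) : LassoFun l a) ∈ lassoEigenspace l a q₁ q₂ μ :=
  ⟨u₁, du₁, u₂, du₂, h, fun _ => rfl, fun _ => rfl⟩

/-- A zero of the characteristic function with `u k l > 0` gives an eigenvalue. -/
theorem eigenspace_ne_bot_of_lassoChar_eq_zero {l a : ℝ} (hl : 0 < l) (ha : 0 < a)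
    {q₁ q₂ : ℝ → ℝ} {Λ K : ℝ} (hΛ : 1 ≤ Λ) {u v c c' s s' : ℝ → ℝ → ℝ}
    (hu : IsSolutionFamily l q₁ 1 0 Λ K u v) (hc : IsSolutionFamily a q₂ 1 0 Λ K c c')
    (hs : IsSolutionFamily a q₂ 0 1 Λ K s s') {k : ℝ} (hk : Λ ≤ k)
    (hD : lassoChar l a u v c s s' k = 0) (hup : 0 < u k l) :
    lassoEigenspace l a q₁ q₂ (k ^ 2) ≠ ⊥ := by
  have hw := wronskian_eq_one ha hΛ hc hs hk
  unfold lassoChar at hD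
  by_cases h0 : s k a = 0
  · -- The sine-type solution on the ring, extended by zero to the edge, is an eigenfunction.
    have htr : c k a + s' k a = 2 := by
      rw [h0, zero_mul, sub_zero] at hD
      linarith [(mul_eq_zero.1 hD).resolve_right hup.ne']
    rw [h0, mul_zero, sub_zero] at hw
    have hs1 : s' k a = 1 := by nlinarith [sq_nonneg (s' k a - 1)]
    have hsol : IsLassoSolution l a q₁ q₂ (k ^ 2) (fun _ => 0) (fun _ => 0) (s k)
        (fun x => k * s' k x) :=
      ⟨.zero _ _ _, hs.sol k hk, rfl, (hs.init k hk).symm, h0.symm, by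
        simp [hs.init_deriv k hk, hs1]⟩
    obtain ⟨⟨x, hx, hx0⟩, -⟩ := sine_solution_norm_pos ha hΛ hs hk
    exact (Submodule.ne_bot_iff _).2 ⟨_, hsol.mem_eigenspace, fun h =>
      hx0 (congrFun (congrArg Prod.snd h) ⟨x, hx⟩)⟩
  · set γ : ℝ := u k l * (1 - c k a) / s k a with hγ
    have hγs : γ * s k a = u k l * (1 - c k a) := by rw [hγ]; field_simp
    have hsol : IsLassoSolution l a q₁ q₂ (k ^ 2) (u k) (fun x => k * v k x)
        (u k l • c k + γ • s k) (u k l • (fun x => k * c' k x) + γ • (fun x => k * s' k x)) := by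
      refine ⟨hu.sol k hk, ((hc.sol k hk).smul _).add ((hs.sol k hk).smul _), ?_, ?_, ?_, ?_⟩
      · simp [hu.init_deriv k hk]
      · simp [hc.init k hk, hs.init k hk]
      · simp only [Pi.add_apply, Pi.smul_apply, smul_eq_mul]
        linear_combination -hγs
      · simp only [Pi.add_apply, Pi.smul_apply, smul_eq_mul, hc.init_deriv k hk,
          hs.init_deriv k hk]
        apply mul_left_cancel₀ h0
        linear_combination k * hD + k * u k l * hw + k * (1 - s' k a) * hγs
    refine (Submodule.ne_bot_iff _).2 ⟨_, hsol.mem_eigenspace, fun h => ?_⟩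
    have h1 : u k 0 = 0 := congrFun (congrArg Prod.fst h) ⟨0, le_rfl, hl.le⟩
    rw [hu.init k hk] at h1
    exact one_ne_zero h1

/-- Under the double eigenvalue condition there are two independent eigenfunctions: one supported
on the ring, and one which does not vanish at the boundary vertex. -/
theorem two_le_rank_eigenspace {l a : ℝ} (hl : 0 < l) (ha : 0 < a)
    {q₁ q₂ : ℝ → ℝ} {Λ K : ℝ} (hΛ : 1 ≤ Λ) {u v c c' s s' : ℝ → ℝ → ℝ}
    (hu : IsSolutionFamily l q₁ 1 0 Λ K u v) (hc : IsSolutionFamily a q₂ 1 0 Λ K c c')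
    (hs : IsSolutionFamily a q₂ 0 1 Λ K s s') {k : ℝ} (hk : Λ ≤ k) (h0 : s k a = 0)
    (hc1 : c k a = 1) (hs1 : s' k a = 1) (hE : c' k a * u k l + v k l = 0) :
    2 ≤ Module.rank ℝ (lassoEigenspace l a q₁ q₂ (k ^ 2)) := by
  have hsol : IsLassoSolution l a q₁ q₂ (k ^ 2) (fun _ => 0) (fun _ => 0) (s k)
      (fun x => k * s' k x) :=
    ⟨.zero _ _ _, hs.sol k hk, rfl, (hs.init k hk).symm, h0.symm, by
      simp [hs.init_deriv k hk, hs1]⟩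
  have hsol' : IsLassoSolution l a q₁ q₂ (k ^ 2) (u k) (fun x => k * v k x)
      (u k l • c k) (u k l • (fun x => k * c' k x)) := by
    refine ⟨hu.sol k hk, (hc.sol k hk).smul _, ?_, ?_, ?_, ?_⟩
    · simp [hu.init_deriv k hk]
    · simp [hc.init k hk]
    · simp [hc1]
    · simp only [Pi.smul_apply, smul_eq_mul, hc.init_deriv k hk]
      linear_combination -k * hE
  obtain ⟨⟨x, hx, hx0⟩, -⟩ := sine_solution_norm_pos ha hΛ hs hk
  have hli : LinearIndependent ℝ
      ![(⟨_, hsol.mem_eigenspace⟩ : lassoEigenspace l a q₁ q₂ (k ^ 2)),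
        ⟨_, hsol'.mem_eigenspace⟩] := by
    rw [LinearIndependent.pair_iff]
    intro α β h
    have h1 := congrArg Subtype.val h
    have h2 : α * 0 + β * u k 0 = 0 := congrFun (congrArg Prod.fst h1) ⟨0, le_rfl, hl.le⟩
    have h3 : α * s k x + β * (u k l * c k x) = 0 := congrFun (congrArg Prod.snd h1) ⟨x, hx⟩
    have hβ : β = 0 := by
      rw [hu.init k hk] at h2
      linarith
    rw [hβ, zero_mul, add_zero] at h3
    exact ⟨(mul_eq_zero.1 h3).resolve_right hx0, hβ⟩
  simpa using hli.cardinal_le_rank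

/-- Arbitrarily large wave numbers `k` carry either a double eigenvalue `k²` or a pair of
eigenvalues `k²`, `k'²` with `k'` within `ε` of `k`. -/
theorem exists_double_or_close_eigenvalues {l a : ℝ} (hl : 0 < l) (ha : 0 < a) {q₁ q₂ : ℝ → ℝ}
    (hq₁ : IntegrableOn q₁ (Icc 0 l) volume) (hq₂ : IntegrableOn q₂ (Icc 0 a) volume)
    {ε : ℝ} (hε : 0 < ε) (M : ℝ) :
    (∃ k, 0 < k ∧ M ≤ k ∧ 2 ≤ Module.rank ℝ (lassoEigenspace l a q₁ q₂ (k ^ 2))) ∨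
    ∃ k k', 0 < k ∧ M ≤ k ∧ k < k' ∧ k' - k < ε ∧ lassoEigenspace l a q₁ q₂ (k ^ 2) ≠ ⊥ ∧
      lassoEigenspace l a q₁ q₂ (k' ^ 2) ≠ ⊥ := by
  obtain ⟨Λ₁, K₁, hΛ₁, hK₁, u, v, hu⟩ :=
    exists_solutionFamily hl hq₁ (p := 1) (r := 0) (by simp) (by simp)
  obtain ⟨Λ₂, K₂, hΛ₂, hK₂, c, c', hc⟩ :=
    exists_solutionFamily ha hq₂ (p := 1) (r := 0) (by simp) (by simp)
  obtain ⟨Λ₃, K₃, hΛ₃, hK₃, s, s', hs⟩ :=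
    exists_solutionFamily ha hq₂ (p := 0) (r := 1) (by simp) (by simp)
  replace hu := hu.mono (Λ' := Λ₁ + Λ₂ + Λ₃) (K' := K₁ + K₂ + K₃) hΛ₁ (by linarith) (by linarith)
  replace hc := hc.mono (Λ' := Λ₁ + Λ₂ + Λ₃) (K' := K₁ + K₂ + K₃) hΛ₂ (by linarith) (by linarith)
  replace hs := hs.mono (Λ' := Λ₁ + Λ₂ + Λ₃) (K' := K₁ + K₂ + K₃) hΛ₃ (by linarith) (by linarith)
  have hΛ : 1 ≤ Λ₁ + Λ₂ + Λ₃ := by linarith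
  have hK : 0 ≤ K₁ + K₂ + K₃ := by linarith
  rcases double_or_two_zeros hl ha hΛ hK hu hc hs hε M with
    ⟨ν, h1, h2, h3, h4, h5, h6⟩ | ⟨k, k', h1, h2, h3, h4, h5, h6, h7, h8⟩
  · exact Or.inl ⟨ν, by linarith, h2, two_le_rank_eigenspace hl ha hΛ hu hc hs h1 h3 h4 h5 h6⟩
  · exact Or.inr ⟨k, k', by linarith, h2, h3, h4,
      eigenspace_ne_bot_of_lassoChar_eq_zero hl ha hΛ hu hc hs h1 h5 h7,
      eigenspace_ne_bot_of_lassoChar_eq_zero hl ha hΛ hu hc hs (h1.trans h3.le) h6 h8⟩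

/-! ### Countability of the spectrum -/

/-- Eigenfunctions for different eigenvalues are orthogonal: the boundary terms in the Lagrange
identities of the edge and of the ring cancel by the vertex conditions. -/
theorem IsLassoSolution.orthogonal {l a : ℝ} (hl : 0 ≤ l) (ha : 0 ≤ a) {q₁ q₂ : ℝ → ℝ} {μ ν : ℝ}
    (hμν : μ ≠ ν) {u₁ du₁ u₂ du₂ v₁ dv₁ v₂ dv₂ : ℝ → ℝ}
    (hu : IsLassoSolution l a q₁ q₂ μ u₁ du₁ u₂ du₂)
    (hv : IsLassoSolution l a q₁ q₂ ν v₁ dv₁ v₂ dv₂) :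
    (∫ x in (0 : ℝ)..l, u₁ x * v₁ x) + ∫ x in (0 : ℝ)..a, u₂ x * v₂ x = 0 := by
  have h1 := hu.edge.lagrange hl hv.edge
  have h2 := hu.ring.lagrange ha hv.ring
  rw [hu.neumann, hv.neumann] at h1
  rw [← hu.cont_left, ← hu.cont_right, ← hv.cont_left, ← hv.cont_right] at h2
  have h3 := hu.kirchhoff
  have h4 := hv.kirchhoff
  apply mul_left_cancel₀ (sub_ne_zero.2 hμν)
  linear_combination -h1 - h2 + v₁ l * h3 - u₁ l * h4

/-- In a second countable space, a family is indexed by a countable type if every member has a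
neighbourhood that no other member meets. -/
theorem countable_of_isolated_family {ι X : Type*} [TopologicalSpace X]
    [SecondCountableTopology X] (f : ι → X) (U : ι → Set X) (hU : ∀ i, IsOpen (U i))
    (hmem : ∀ i, f i ∈ U i) (hne : ∀ i j, i ≠ j → f j ∉ U i) : Countable ι := by
  let _ : TopologicalSpace ι := TopologicalSpace.induced f inferInstance
  have : SecondCountableTopology ι := TopologicalSpace.secondCountableTopology_induced ι X f
  have : DiscreteTopology ι := by
    rw [discreteTopology_iff_isOpen_singleton]
    intro i
    rw [isOpen_induced_iff]
    refine ⟨U i, hU i, ?_⟩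
    ext j
    simp only [mem_preimage, mem_singleton_iff]
    refine ⟨fun h => ?_, fun h => h ▸ hmem i⟩
    by_contra hji
    exact hne i j (Ne.symm hji) h
  exact countable_of_Lindelof_of_discrete

/-- The spectrum is countable: eigenfunctions for different eigenvalues are orthogonal, hence
isolated from each other in a separable space of continuous functions. -/
theorem countable_eigenvalues {l a : ℝ} (hl : 0 < l) (ha : 0 < a) (q₁ q₂ : ℝ → ℝ) :
    {μ : ℝ | lassoEigenspace l a q₁ q₂ μ ≠ ⊥}.Countable := by
  have hex : ∀ μ : {μ : ℝ | lassoEigenspace l a q₁ q₂ μ ≠ ⊥}, ∃ u₁ du₁ u₂ du₂ : ℝ → ℝ,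
      IsLassoSolution l a q₁ q₂ μ u₁ du₁ u₂ du₂ ∧
      0 < (∫ x in (0 : ℝ)..l, u₁ x * u₁ x) + ∫ x in (0 : ℝ)..a, u₂ x * u₂ x := by
    rintro ⟨μ, hμ⟩
    obtain ⟨φ, ⟨u₁, du₁, u₂, du₂, hu, h1, h2⟩, hφ⟩ := (Submodule.ne_bot_iff _).1 hμ
    refine ⟨u₁, du₁, u₂, du₂, hu, ?_⟩
    have n1 : 0 ≤ ∫ x in (0 : ℝ)..l, u₁ x * u₁ x :=
      intervalIntegral.integral_nonneg hl.le fun _ _ => mul_self_nonneg _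
    have n2 : 0 ≤ ∫ x in (0 : ℝ)..a, u₂ x * u₂ x :=
      intervalIntegral.integral_nonneg ha.le fun _ _ => mul_self_nonneg _
    by_cases hc : ∃ x ∈ Icc 0 l, u₁ x ≠ 0
    · obtain ⟨x, hx, hx0⟩ := hc
      have := integral_mul_self_pos hl hu.edge.continuousOn hx hx0
      linarith
    by_cases hc' : ∃ x ∈ Icc 0 a, u₂ x ≠ 0
    · obtain ⟨x, hx, hx0⟩ := hc'
      have := integral_mul_self_pos ha hu.ring.continuousOn hx hx0
      linarith
    push Not at hc hc'
    refine absurd (Prod.ext (funext fun x => ?_) (funext fun x => ?_)) hφ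
    · rw [h1 x, hc x x.2]; rfl
    · rw [h2 x, hc' x x.2]; rfl
  choose u₁ du₁ u₂ du₂ hu hpos using hex
  let f : {μ : ℝ | lassoEigenspace l a q₁ q₂ μ ≠ ⊥} →
      C(Icc (0 : ℝ) l, ℝ) × C(Icc (0 : ℝ) a, ℝ) := fun μ =>
    (⟨_, (hu μ).edge.continuousOn.domRestrict⟩, ⟨_, (hu μ).ring.continuousOn.domRestrict⟩)
  let P : C(Icc (0 : ℝ) l, ℝ) × C(Icc (0 : ℝ) a, ℝ) →
      C(Icc (0 : ℝ) l, ℝ) × C(Icc (0 : ℝ) a, ℝ) → ℝ := fun φ ψ =>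
    (∫ x in (0 : ℝ)..l, φ.1 (projIcc 0 l hl.le x) * ψ.1 (projIcc 0 l hl.le x)) +
      ∫ x in (0 : ℝ)..a, φ.2 (projIcc 0 a ha.le x) * ψ.2 (projIcc 0 a ha.le x)
  have hP : ∀ φ, Continuous (P φ) := by
    intro φ
    have c1 : Continuous (projIcc 0 l hl.le) := continuous_projIcc
    have c2 : Continuous (projIcc 0 a ha.le) := continuous_projIcc
    refine Continuous.add ?_ ?_
    · apply intervalIntegral.continuous_parametric_intervalIntegral_of_continuous'
      simp only [Function.uncurry_def]
      fun_prop
    · apply intervalIntegral.continuous_parametric_intervalIntegral_of_continuous'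
      simp only [Function.uncurry_def]
      fun_prop
  have hPf : ∀ μ ν, P (f μ) (f ν) = (∫ x in (0 : ℝ)..l, u₁ μ x * u₁ ν x) +
      ∫ x in (0 : ℝ)..a, u₂ μ x * u₂ ν x := by
    intro μ ν
    refine congrArg₂ (· + ·) ?_ ?_
    · apply intervalIntegral.integral_congr
      intro x hx
      rw [uIcc_of_le hl.le] at hx
      simp [f, projIcc_of_mem hl.le hx]
    · apply intervalIntegral.integral_congr
      intro x hx
      rw [uIcc_of_le ha.le] at hx
      simp [f, projIcc_of_mem ha.le hx]
  rw [← countable_coe_iff]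
  refine countable_of_isolated_family f (fun μ => {ψ | 0 < P (f μ) ψ})
    (fun μ => isOpen_lt continuous_const (hP _)) (fun μ => ?_) (fun μ ν hμν h => ?_)
  · change 0 < P (f μ) (f μ)
    rw [hPf]
    exact hpos μ
  · change 0 < P (f μ) (f ν) at h
    rw [hPf, (hu μ).orthogonal hl.le ha.le (fun h => hμν (Subtype.ext h)) (hu ν)] at h
    exact lt_irrefl _ h

theorem infinite_eigenvalues {l a : ℝ} (hl : 0 < l) (ha : 0 < a) {q₁ q₂ : ℝ → ℝ}
    (hq₁ : IntegrableOn q₁ (Icc 0 l) volume) (hq₂ : IntegrableOn q₂ (Icc 0 a) volume) :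
    {μ : ℝ | lassoEigenspace l a q₁ q₂ μ ≠ ⊥}.Infinite := by
  refine infinite_of_not_bddAbove ?_
  rintro ⟨B, hB⟩
  have key : ∃ k, |B| + 1 ≤ k ∧ lassoEigenspace l a q₁ q₂ (k ^ 2) ≠ ⊥ := by
    rcases exists_double_or_close_eigenvalues hl ha hq₁ hq₂ one_pos (|B| + 1) with
      ⟨k, -, hk, hr⟩ | ⟨k, -, -, hk, -, -, hr, -⟩
    · refine ⟨k, hk, fun h => ?_⟩
      rw [h, rank_bot] at hr
      exact absurd hr (by simp)
    · exact ⟨k, hk, hr⟩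
  obtain ⟨k, hk, hr⟩ := key
  have h1 : k ^ 2 ≤ B := hB hr
  nlinarith [le_abs_self B, abs_nonneg B]

/-! ### Enumerations with multiplicity -/

theorem ENat.encard_setOf_natCast_lt (m : ℕ∞) : {i : ℕ | (i : ℕ∞) < m}.encard = m := by
  induction m using ENat.recTopCoe with
  | top =>
    have : {i : ℕ | (i : ℕ∞) < ⊤} = univ := by ext i; simp
    rw [this, encard_univ]
    simp
  | coe n =>
    have : {i : ℕ | (i : ℕ∞) < n} = (Finset.range n : Set ℕ) := by ext i; simp
    rw [this, encard_coe_eq_coe_finsetCard, Finset.card_range]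

/-- A multiplicity function with countably infinite support is realized by a sequence. -/
theorem exists_seq_of_multiplicity {α : Type*} (m : α → ℕ∞) (hc : {x | m x ≠ 0}.Countable)
    (hi : {x | m x ≠ 0}.Infinite) : ∃ ev : ℕ → α, ∀ x, {n | ev n = x}.encard = m x := by
  -- The points of the support, each taken with `m x` labels.
  let S := Σ x : α, {i : ℕ | (i : ℕ∞) < m x}
  have hS : ∀ z : S, m z.1 ≠ 0 := fun z h => by
    have := z.2.2
    simp [h] at this
  have : Countable {x | m x ≠ 0} := hc.to_subtype
  have : Infinite {x | m x ≠ 0} := hi.to_subtype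
  have : Countable S := by
    let g : S → {x | m x ≠ 0} × ℕ := fun z => (⟨z.1, hS z⟩, z.2.1)
    refine Function.Injective.countable (f := g) ?_
    rintro ⟨x, i, hx⟩ ⟨y, j, hy⟩ h
    simp only [g, Prod.mk.injEq, Subtype.mk.injEq] at h
    obtain ⟨rfl, rfl⟩ := h
    rfl
  have : Infinite S := by
    let g : {x | m x ≠ 0} → S := fun x => ⟨x.1, 0, by
      simpa using pos_iff_ne_zero.2 x.2⟩
    refine Infinite.of_injective g fun x y h => Subtype.ext ?_
    exact congrArg Sigma.fst h
  obtain ⟨e⟩ : Nonempty (ℕ ≃ S) := by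
    obtain ⟨d⟩ := nonempty_denumerable S
    exact ⟨(Denumerable.eqv S).symm⟩
  refine ⟨fun n => (e n).1, fun x => ?_⟩
  rw [← ENat.encard_setOf_natCast_lt (m x)]
  let F : {i : ℕ | (i : ℕ∞) < m x} → ℕ := fun i => e.symm ⟨x, i⟩
  have hF : Function.Injective F := fun i j h => by
    exact eq_of_heq (Sigma.mk.inj (e.symm.injective h)).2
  have hrange : {n | (e n).1 = x} = range F := by
    ext n
    constructor
    · intro h
      rcases hz : e n with ⟨y, i⟩
      have hy : y = x := by
        have h' : (e n).1 = x := h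
        rwa [hz] at h'
      subst hy
      exact ⟨i, by simp [F, ← hz]⟩
    · rintro ⟨i, rfl⟩
      simp [F]
  rw [hrange, ← image_univ, hF.encard_image, encard_univ]
  rfl

/-! ### Eigenfrequencies -/

theorem eigenfrequency_sq_of_pos {k : ℝ} (hk : 0 < k) : eigenfrequency (k ^ 2) = (k : ℂ) := by
  have h1 : Real.sqrt (-k ^ 2) = 0 := Real.sqrt_eq_zero'.2 (by nlinarith [sq_nonneg k])
  apply Complex.ext <;> simp [eigenfrequency, Real.sqrt_sq hk.le, h1]

theorem mainTheorem5 (l a : ℝ) (hl : 0 < l) (ha : 0 < a) (q₁ q₂ : ℝ → ℝ)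
    (hq₁ : IntegrableOn q₁ (Icc 0 l) volume) (hq₂ : IntegrableOn q₂ (Icc 0 a) volume) :
    (∃ ev : ℕ → ℝ, IsLassoEigenvalueSeq l a q₁ q₂ ev) ∧
    ∀ ev : ℕ → ℝ, IsLassoEigenvalueSeq l a q₁ q₂ ev →
      IsGLB {d : ℝ | ∃ m n : ℕ, m ≠ n ∧
        d = ‖eigenfrequency (ev m) - eigenfrequency (ev n)‖} 0 := by
  constructor
  · have hset : {μ : ℝ | Cardinal.toENat (Module.rank ℝ (lassoEigenspace l a q₁ q₂ μ)) ≠ 0} =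
        {μ : ℝ | lassoEigenspace l a q₁ q₂ μ ≠ ⊥} := by
      ext μ
      simp [Submodule.rank_eq_zero]
    exact exists_seq_of_multiplicity
      (fun μ => Cardinal.toENat (Module.rank ℝ (lassoEigenspace l a q₁ q₂ μ)))
      (hset ▸ countable_eigenvalues hl ha q₁ q₂) (hset ▸ infinite_eigenvalues hl ha hq₁ hq₂)
  · intro ev hev
    have hmem : ∀ μ, lassoEigenspace l a q₁ q₂ μ ≠ ⊥ → ∃ n, ev n = μ := by
      intro μ hμ
      have h1 : {n | ev n = μ}.encard ≠ 0 := by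
        rw [hev μ, Ne, Cardinal.toENat_eq_zero, Submodule.rank_eq_zero]
        exact hμ
      exact nonempty_iff_ne_empty.2 (encard_ne_zero.1 h1 |>.ne_empty)
    refine ⟨?_, fun B hB => ?_⟩
    · rintro d ⟨m, n, -, rfl⟩
      exact norm_nonneg _
    · by_contra! hB0
      rcases exists_double_or_close_eigenvalues hl ha hq₁ hq₂ hB0 0 with
        ⟨k, -, -, hr⟩ | ⟨k, k', hk, -, hkk', hlt, hr, hr'⟩
      · have h1 : 1 < {n | ev n = k ^ 2}.encard := by
          rw [hev]
          have h2 : Cardinal.toENat 2 ≤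
              Cardinal.toENat (Module.rank ℝ (lassoEigenspace l a q₁ q₂ (k ^ 2))) :=
            Cardinal.toENat.monotone' hr
          refine lt_of_lt_of_le ?_ h2
          simp
        obtain ⟨m, n, hm, hn, hmn⟩ := one_lt_encard_iff.1 h1
        have hm' : ev m = k ^ 2 := hm
        have hn' : ev n = k ^ 2 := hn
        have h3 := hB ⟨m, n, hmn, rfl⟩
        rw [hm', hn', sub_self, norm_zero] at h3
        linarith
      · obtain ⟨m, hm⟩ := hmem _ hr'
        obtain ⟨n, hn⟩ := hmem _ hr
        have hmn : m ≠ n := by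
          rintro rfl
          have : k ^ 2 < k' ^ 2 := by nlinarith
          linarith
        have h3 := hB ⟨m, n, hmn, rfl⟩
        rw [hm, hn, eigenfrequency_sq_of_pos hk, eigenfrequency_sq_of_pos (hk.trans hkk'),
          ← Complex.ofReal_sub, Complex.norm_real, Real.norm_of_nonneg (by linarith)] at h3
        linarith
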